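/- Let $\lambda=\lambda(x,W)\in C^1([0,1]\times[0,\infty))$ with $\lambda>0$. Let $T>0$, let $\rho_0\in L^\infty(0,1)$ and $u\in L^\infty(0,T)$ be nonnegative almost everywhere, and consider the Cauchy problem $$\rho_t(t,x)+\big(\rho(t,x)\,\lambda(x,W(t))\big)_x=0,\qquad W(t)=\int_0^1\rho(t,x)\,dx,\qquad 0\le t\le T,\ 0\le x\le 1,$$ $$\rho(0,x)=\rho_0(x),\qquad \rho(t,0)\,\lambda(0,W(t))=u(t).$$ A weak solution is a function $\rho\in C^0([0,T];L^1(0,1))\cap L^\infty((0,T)\times(0,1))$ with $W(t)\ge 0$ for all $t\in[0,T]$ (so that $\lambda(x,W(t))$ is defined) such that, for every $\tau\in[0,T]$ and every $\varphi\in C^1([0,\tau]\times[0,1])$ with $\varphi(\tau,x)=0$ for all $x\in[0,1]$ and $\varphi(t,1)=0$ for all $t\in[0,\tau]$, $$\int_0^\tau\!\!\int_0^1\rho(t,x)\big(\varphi_t(t,x)+\lambda(x,W(t))\,\varphi_x(t,x)\big)\,dx\,dt+\int_0^\tau u(t)\varphi(t,0)\,dt+\int_0^1\rho_0(x)\varphi(0,x)\,dx=0.$$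 Then the Cauchy problem admits a unique weak solution $\rho\in C^0([0,T];L^1(0,1))\cap L^\infty((0,T)\times(0,1))$. It is nonnegative almost everywhere in $[0,T]\times[0,1]$, and it belongs to $C^0([0,T];L^p(0,1))$ for all $p\in[1,\infty)$. -/

import Mathlib

open MeasureTheory Set Filter Topology
open scoped ENNReal

noncomputable section

namespace NonlocalConservation

/-- `f` represents an element of `L^∞_+(a,b)`: measurable, essentially bounded and nonnegative
almost everywhere on `(a,b)`. -/
def MemLinftyPlus (a b : ℝ) (f : ℝ → ℝ) : Prop :=
  MemLp f ∞ (volume.restrict (Ioo a b)) ∧ ∀ᵐ x ∂(volume.restrict (Ioo a b)), 0 ≤ f x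

/-- `ρ` represents an element of `C⁰([0,T]; L^p(0,1))`: every time slice `ρ t`, `t ∈ [0,T]`, is in
`L^p(0,1)`, and `t ↦ ρ t` is continuous on `[0,T]` for the `L^p(0,1)` norm. -/
def ContinuousInLp (T : ℝ) (p : ℝ≥0∞) (ρ : ℝ → ℝ → ℝ) : Prop :=
  (∀ t ∈ Icc 0 T, MemLp (ρ t) p (volume.restrict (Ioo 0 1))) ∧
  ∀ t ∈ Icc 0 T,
    Tendsto (fun s => eLpNorm (fun x => ρ s x - ρ t x) p (volume.restrict (Ioo 0 1)))
      (𝓝[Icc 0 T] t) (𝓝 0)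

/-- The total mass `W(t) = ∫₀¹ ρ(t,x) dx`. -/
def totalMass (ρ : ℝ → ℝ → ℝ) (t : ℝ) : ℝ := ∫ x in (0 : ℝ)..1, ρ t x

/-- Admissible test functions on `[0,τ] × [0,1]`: functions `φ(t,x)` of class `C¹` there (up to the
boundary) that vanish at `t = τ` and at `x = 1`. -/
structure IsTestFunction (τ : ℝ) (φ : ℝ → ℝ → ℝ) : Prop where
  contDiffOn : ContDiffOn ℝ 1 (fun z : ℝ × ℝ => φ z.1 z.2) (Icc 0 τ ×ˢ Icc 0 1)
  final_eq_zero : ∀ x ∈ Icc (0 : ℝ) 1, φ τ x = 0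
  right_eq_zero : ∀ t ∈ Icc 0 τ, φ t 1 = 0

/-- Weak solutions on `[0,T]` of `ρ_t + (ρ lam(x,W(t)))_x = 0`, `W(t) = ∫₀¹ ρ(t,x) dx`, with
`ρ(0,·) = ρ₀` and `ρ(t,0) lam(0,W(t)) = u(t)`. The velocity `lam` is a function on
`[0,1] × [0,∞)` (its values elsewhere are irrelevant), so `lam(x,W(t))` makes sense only if
`W(t) ≥ 0`; this is the field `mass_nonneg`. -/
structure IsWeakSolution (lam : ℝ → ℝ → ℝ) (T : ℝ) (ρ₀ u : ℝ → ℝ) (ρ : ℝ → ℝ → ℝ) : Prop where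
  continuousInL1 : ContinuousInLp T 1 ρ
  memLinfty : MemLp (fun z : ℝ × ℝ => ρ z.1 z.2) ∞ (volume.restrict (Ioo 0 T ×ˢ Ioo 0 1))
  mass_nonneg : ∀ t ∈ Icc 0 T, 0 ≤ totalMass ρ t
  weak_eq : ∀ τ ∈ Icc 0 T, ∀ φ : ℝ → ℝ → ℝ, IsTestFunction τ φ →
    (∫ t in (0 : ℝ)..τ, ∫ x in (0 : ℝ)..1,
        ρ t x * (derivWithin (fun s => φ s x) (Icc 0 τ) t +
          lam x (totalMass ρ t) * derivWithin (fun y => φ t y) (Icc 0 1) x)) +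
      (∫ t in (0 : ℝ)..τ, u t * φ t 0) +
      (∫ x in (0 : ℝ)..1, ρ₀ x * φ 0 x) = 0

end NonlocalConservation

end

/-!
# A conservation law with nonlocal velocity

Once the total mass `W` is known, the equation is a linear transport equation: mass is carried
along the characteristics `X' = lam(X, W(t))`. After an extension of the velocity from
`[0,1] × [0,B]` to a Lipschitz field on the plane that is bounded below by a positive constant
(`exists_isVelocity_eqOn`), characteristics are globally defined and strictly increasing, so mass
enters only at `x = 0` and leaves only at `x = 1`, and nothing is lost in between.

*The fixed point.* At time `τ` let `X` be the characteristic through `(τ, 1)`. What is in `[0,1]` at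
that time is exactly the initial mass at positions below `X(0)` and the mass that entered at times
`t ∈ (0, τ)` with `X(t) > 0`; this is `massBehind`. As `X` is determined by `W` on `[0, τ]`,
the total mass is a fixed point of a map `W ↦ massFunctional W`. Two characteristics arriving at
`(τ, 1)` are at distance at most a constant times `∫₀^τ |W₁ - W₂|`, the data are bounded, and the
velocity is bounded below, so the map is of Volterra type and has exactly one fixed point in
`C⁰([0,T])`, without any smallness of `T` (`existsUnique_massFunctional_fixedPoint`).

*Uniqueness.* Test a weak solution against smooth cutoffs that converge to the indicator of the
region behind the characteristic of its own `W` through `(τ, y)`. Their derivatives along the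
characteristics are bounded and tend to zero, as the velocity is Lipschitz. The result is that the
mass in `(0, y)` at time `τ` is the mass of the data behind that characteristic
(`IsWeakSolution.setIntegral_Iio_eq_massBehind`). For `y = 1` this says that `W` is the fixed point,
hence the same for all weak solutions; for the other `y` it then determines the density.

*Existence.* Let `W` be the fixed point. The data are pushed forward by the flow as measures
(`massAt`): the initial mass from time `0`, the boundary mass `u(s) ds` from the point `0` at time
`s`. Neither map contracts distances by more than a fixed factor, so the measure on `[0,1]` has a
bounded density, which can be chosen jointly measurable (`exists_measurable_density`). Its total
mass is `W`, because `W` is the fixed point. The weak formulation is the fundamental theorem of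
calculus for a test function along each characteristic (`IsTestFunction.integral_materialDeriv`),
integrated against the data.

*Continuity in time.* The measures at nearby times differ by a map close to the identity, which
changes the mass of all sets little, uniformly, as in the continuity of translations in `L¹`
(`exists_measureReal_preimage_le`). This is continuity in `L¹`, and with the uniform bound on the
density it gives continuity in `L^p` for every `p < ∞`.
-/

noncomputable section

namespace NonlocalConservation

/-! ### Characteristics of a Lipschitz velocity field -/

/-- A velocity field on the whole plane: jointly Lipschitz with constant `L`, bounded below by
`c > 0` and above by `Λ`. -/
structure IsVelocity (vel : ℝ → ℝ → ℝ) (L c Λ : ℝ) : Prop where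
  L_nonneg : 0 ≤ L
  c_pos : 0 < c
  lipschitz : ∀ x y w z, |vel x w - vel y z| ≤ L * (|x - y| + |w - z|)
  lower : ∀ x w, c ≤ vel x w
  upper : ∀ x w, vel x w ≤ Λ

/-- `X` is a characteristic curve: it solves `X' = vel(X, W(t))` on the whole line. -/
def IsCharacteristic (vel : ℝ → ℝ → ℝ) (W X : ℝ → ℝ) : Prop :=
  ∀ t, HasDerivAt X (vel (X t) (W t)) t

/-- Integral form of Gronwall's inequality, in both time directions. -/
theorem abs_le_exp_mul_of_abs_deriv_le {f f' g : ℝ → ℝ} {L : ℝ} (hL : 0 ≤ L)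
    (hf : ∀ t, HasDerivAt f (f' t) t) (hg : Continuous g) (hg0 : ∀ t, 0 ≤ g t)
    (h : ∀ t, |f' t| ≤ L * |f t| + g t) (s t : ℝ) :
    |f t| ≤ Real.exp (L * |t - s|) * (|f s| + |∫ r in s..t, g r|) := by
  have key : ∀ {f f' g : ℝ → ℝ} (_ : ∀ t, HasDerivAt f (f' t) t) (_ : Continuous g)
      (_ : ∀ t, 0 ≤ g t) (_ : ∀ t, |f' t| ≤ L * |f t| + g t) {s t : ℝ} (_ : s ≤ t),
      |f t| ≤ Real.exp (L * (t - s)) * (|f s| + ∫ r in s..t, g r) := by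
    intro f f' g hf hg hg0 h s t hst
    have hδ : ∀ δ > 0, |f t| ≤
        Real.exp (L * (t - s)) * (|f s| + δ * (t - s) + ∫ r in s..t, g r) := by
      intro δ hδ
      have hB : ∀ r, HasDerivAt
          (fun r => Real.exp (L * (r - s)) * (|f s| + δ * (r - s) + ∫ r in s..r, g r))
          (Real.exp (L * (r - s)) * L * (|f s| + δ * (r - s) + ∫ r in s..r, g r) +
            Real.exp (L * (r - s)) * (δ + g r)) r := by
        intro r
        have h1 : HasDerivAt (fun r : ℝ => L * (r - s)) L r := by
          simpa using ((hasDerivAt_id r).sub_const s).const_mul L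
        have h2 : HasDerivAt (fun r : ℝ => |f s| + δ * (r - s)) δ r := by
          simpa using (((hasDerivAt_id r).sub_const s).const_mul δ).const_add (|f s|)
        exact h1.exp.mul (h2.add (hg.integral_hasStrictDerivAt s r).hasDerivAt)
      refine image_norm_le_of_norm_deriv_right_lt_deriv_boundary' (a := s) (b := t) (f := f)
        (f' := f') (fun r _ => (hf r).continuousAt.continuousWithinAt)
        (fun r _ => (hf r).hasDerivWithinAt) (by simp)
        (fun r _ => (hB r).continuousAt.continuousWithinAt)
        (fun r _ => (hB r).hasDerivWithinAt) ?_ ⟨hst, le_rfl⟩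
      intro r hr hfr
      rw [Real.norm_eq_abs] at hfr ⊢
      refine (h r).trans_lt ?_
      rw [hfr]
      have he : 1 ≤ Real.exp (L * (r - s)) :=
        Real.one_le_exp (mul_nonneg hL (sub_nonneg.2 hr.1))
      nlinarith [hg0 r]
    refine le_of_forall_pos_le_add fun ε hε => ?_
    have hE := Real.exp_pos (L * (t - s))
    have := hδ (ε / (Real.exp (L * (t - s)) * (t - s + 1)))
      (by have : 0 < t - s + 1 := by linarith
          positivity)
    refine this.trans ?_
    have h1 : 0 < t - s + 1 := by linarith
    have h2 : Real.exp (L * (t - s)) * (ε / (Real.exp (L * (t - s)) * (t - s + 1)) * (t - s))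
        ≤ ε := by
      rw [show Real.exp (L * (t - s)) * (ε / (Real.exp (L * (t - s)) * (t - s + 1)) * (t - s)) =
        ε * ((t - s) / (t - s + 1)) by field_simp]
      refine mul_le_of_le_one_right hε.le ?_
      rw [div_le_one h1]; linarith
    linarith
  rcases le_total s t with hst | hst
  · have h0 : 0 ≤ ∫ r in s..t, g r := intervalIntegral.integral_nonneg hst fun r _ => hg0 r
    rw [abs_of_nonneg (sub_nonneg.2 hst), abs_of_nonneg h0]
    exact key hf hg hg0 h hst
  · have h0 : 0 ≤ ∫ r in t..s, g r := intervalIntegral.integral_nonneg hst fun r _ => hg0 r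
    rw [abs_sub_comm, abs_of_nonneg (sub_nonneg.2 hst), intervalIntegral.integral_symm, abs_neg,
      abs_of_nonneg h0]
    have := key (f := fun r => f (-r)) (f' := fun r => -f' (-r)) (g := fun r => g (-r))
      (fun r => by simpa [Function.comp_def] using (hf (-r)).comp r (hasDerivAt_neg r))
      (hg.comp continuous_neg) (fun r => hg0 _) (fun r => by simpa using h (-r))
      (s := -s) (t := -t) (by linarith)
    simpa [neg_add_eq_sub] using this

namespace IsVelocity

variable {vel : ℝ → ℝ → ℝ} {L c Λ : ℝ} {W : ℝ → ℝ}

lemma Λ_pos (hv : IsVelocity vel L c Λ) : 0 < Λ :=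
  hv.c_pos.trans_le ((hv.lower 0 0).trans (hv.upper 0 0))

lemma continuous_uncurry (hv : IsVelocity vel L c Λ) :
    Continuous fun z : ℝ × ℝ => vel z.1 z.2 := by
  refine continuous_iff_continuousAt.2 fun z => ?_
  refine tendsto_iff_dist_tendsto_zero.2 (squeeze_zero (fun _ => dist_nonneg)
    (fun y => (hv.lipschitz y.1 z.1 y.2 z.2)) ?_)
  exact Continuous.tendsto' (by fun_prop) _ _ (by simp)

lemma exists_characteristic_Icc (hv : IsVelocity vel L c Λ) (hW : Continuous W) (s x : ℝ) {R : ℝ}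
    (hR : 0 < R) :
    ∃ X : ℝ → ℝ, X s = x ∧
      ∀ t ∈ Ioo (s - R) (s + R), HasDerivAt X (vel (X t) (W t)) t := by
  have hΛ := hv.Λ_pos
  have hpl : IsPicardLindelof (fun t y => vel y (W t)) (tmin := s - R) (tmax := s + R)
      ⟨s, by constructor <;> linarith⟩ x ⟨Λ * R, by positivity⟩ 0 ⟨Λ, hΛ.le⟩ ⟨L, hv.L_nonneg⟩ := by
    refine ⟨fun t _ => ?_, fun y _ => ?_, fun t _ y _ => ?_, ?_⟩
    · refine LipschitzOnWith.of_dist_le_mul fun y _ z _ => ?_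
      change |_| ≤ L * |_|
      simpa using hv.lipschitz y z (W t) (W t)
    · exact (hv.continuous_uncurry.comp (continuous_const.prodMk hW)).continuousOn
    · rw [Real.norm_eq_abs, abs_of_pos (hv.c_pos.trans_le (hv.lower _ _))]
      exact hv.upper _ _
    · change Λ * max (s + R - s) (s - (s - R)) ≤ Λ * R - 0
      simp
  obtain ⟨X, hX, h⟩ := hpl.exists_eq_forall_mem_Icc_hasDerivWithinAt₀
  exact ⟨X, hX, fun t ht => (h t (Ioo_subset_Icc_self ht)).hasDerivAt (Icc_mem_nhds ht.1 ht.2)⟩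

lemma exists_characteristic (hv : IsVelocity vel L c Λ) (hW : Continuous W) (s x : ℝ) :
    ∃ X : ℝ → ℝ, X s = x ∧ IsCharacteristic vel W X := by
  -- Solutions on `(s - n - 1, s + n + 1)` agree on overlaps, so they patch together.
  choose X hX hX' using fun n : ℕ =>
    hv.exists_characteristic_Icc hW s x (R := (n : ℝ) + 1) (by positivity)
  have huniq : ∀ m n : ℕ, m ≤ n → ∀ t ∈ Ioo (s - (m + 1)) (s + (m + 1)), X m t = X n t := by
    intro m n hmn t ht
    have hc : (m : ℝ) ≤ n := by exact_mod_cast hmn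
    refine ODE_solution_unique_of_mem_Ioo (v := fun t y => vel y (W t)) (s := fun _ => univ)
      (K := ⟨L, hv.L_nonneg⟩) (t₀ := s) (a := s - (m + 1)) (b := s + (m + 1))
      (fun r _ => ?_) ?_ (fun r hr => ⟨hX' m r hr, trivial⟩)
      (fun r hr => ⟨hX' n r ⟨by linarith [hr.1], by linarith [hr.2]⟩, trivial⟩) ?_ ht
    · refine LipschitzOnWith.of_dist_le_mul fun y _ z _ => ?_
      change |_| ≤ L * |_|
      simpa using hv.lipschitz y z (W r) (W r)
    · constructor <;> linarith [(Nat.cast_nonneg m : (0 : ℝ) ≤ m)]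
    · rw [hX, hX]
  refine ⟨fun t => X ⌈|t - s|⌉₊ t, by simpa using hX 0, fun t => ?_⟩
  set n := ⌈|t - s|⌉₊
  have hn : |t - s| < (n : ℝ) + 1 := (Nat.le_ceil _).trans_lt (lt_add_one _)
  have ht : t ∈ Ioo (s - ((n : ℝ) + 1)) (s + (n + 1)) := by
    rw [abs_lt] at hn
    constructor <;> linarith [hn.1, hn.2]
  refine (hX' n t ht).congr_of_eventuallyEq ?_
  filter_upwards [Ioo_mem_nhds ht.1 ht.2] with r hr
  have hr' : r ∈ Ioo (s - (((⌈|r - s|⌉₊ : ℕ) : ℝ) + 1)) (s + ((⌈|r - s|⌉₊ : ℕ) + 1)) := by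
    have := abs_lt.1 ((Nat.le_ceil |r - s|).trans_lt (lt_add_one _))
    constructor <;> linarith [this.1, this.2]
  rcases le_total ⌈|r - s|⌉₊ n with h | h
  · exact huniq _ _ h r hr'
  · exact (huniq _ _ h r hr).symm

end IsVelocity

namespace IsCharacteristic

variable {vel : ℝ → ℝ → ℝ} {L c Λ : ℝ} {W W₁ W₂ X Y : ℝ → ℝ}

lemma continuous (hX : IsCharacteristic vel W X) : Continuous X :=
  continuous_iff_continuousAt.2 fun t => (hX t).continuousAt

/-- Stability of characteristics with respect to the initial position and to `W`. -/
lemma abs_sub_le (hv : IsVelocity vel L c Λ) (hW₁ : Continuous W₁) (hW₂ : Continuous W₂)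
    (hX : IsCharacteristic vel W₁ X) (hY : IsCharacteristic vel W₂ Y) (s t : ℝ) :
    |X t - Y t| ≤
      Real.exp (L * |t - s|) * (|X s - Y s| + L * |∫ r in s..t, (|W₁ r - W₂ r|)|) := by
  have := abs_le_exp_mul_of_abs_deriv_le (f := fun t => X t - Y t)
    (g := fun t => L * |W₁ t - W₂ t|) hv.L_nonneg (fun t => (hX t).sub (hY t)) (by fun_prop)
    (fun t => mul_nonneg hv.L_nonneg (abs_nonneg _))
    (fun t => (hv.lipschitz _ _ _ _).trans_eq (mul_add _ _ _)) s t
  rwa [intervalIntegral.integral_const_mul, abs_mul, abs_of_nonneg hv.L_nonneg] at this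

lemma abs_sub_le_exp (hv : IsVelocity vel L c Λ) (hW : Continuous W)
    (hX : IsCharacteristic vel W X) (hY : IsCharacteristic vel W Y) (s t : ℝ) :
    |X t - Y t| ≤ Real.exp (L * |t - s|) * |X s - Y s| := by
  simpa using abs_sub_le hv hW hW hX hY s t

lemma eq_of_eq (hv : IsVelocity vel L c Λ) (hW : Continuous W)
    (hX : IsCharacteristic vel W X) (hY : IsCharacteristic vel W Y) {s : ℝ} (h : X s = Y s) :
    X = Y := by
  ext t
  have := abs_sub_le_exp hv hW hX hY s t
  rw [h, sub_self, abs_zero, mul_zero] at this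
  exact sub_eq_zero.1 (abs_nonpos_iff.1 this)

lemma lt_of_lt (hv : IsVelocity vel L c Λ) (hW : Continuous W)
    (hX : IsCharacteristic vel W X) (hY : IsCharacteristic vel W Y) {s : ℝ} (h : X s < Y s)
    (t : ℝ) : X t < Y t := by
  by_contra! hle
  obtain ⟨r, hr⟩ := mem_range_of_exists_le_of_exists_ge (c := (0 : ℝ))
    (hX.continuous.sub hY.continuous) ⟨s, by simpa using h.le⟩ ⟨t, by simpa using hle⟩
  have := eq_of_eq hv hW hX hY (sub_eq_zero.1 hr)
  exact h.ne (congrFun this s)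

lemma mul_sub_le (hv : IsVelocity vel L c Λ) (hX : IsCharacteristic vel W X) {s t : ℝ}
    (hst : s ≤ t) : c * (t - s) ≤ X t - X s := by
  refine mul_sub_le_image_sub_of_le_deriv (fun t => (hX t).differentiableAt)
    (fun t => ?_) hst
  rw [(hX t).deriv]
  exact hv.lower _ _

lemma sub_le_mul (hv : IsVelocity vel L c Λ) (hX : IsCharacteristic vel W X) {s t : ℝ}
    (hst : s ≤ t) : X t - X s ≤ Λ * (t - s) := by
  refine image_sub_le_mul_sub_of_deriv_le (fun t => (hX t).differentiableAt)
    (fun t => ?_) hst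
  rw [(hX t).deriv]
  exact hv.upper _ _

lemma strictMono (hv : IsVelocity vel L c Λ) (hX : IsCharacteristic vel W X) : StrictMono X :=
  fun s t hst => by nlinarith [hX.mul_sub_le hv hst.le, hv.c_pos]

lemma mul_abs_sub_le (hv : IsVelocity vel L c Λ) (hX : IsCharacteristic vel W X) (s t : ℝ) :
    c * |t - s| ≤ |X t - X s| := by
  rcases le_total s t with h | h
  · rw [abs_of_nonneg (sub_nonneg.2 h)]
    exact (hX.mul_sub_le hv h).trans (le_abs_self _)
  · rw [abs_sub_comm t, abs_sub_comm (X t), abs_of_nonneg (sub_nonneg.2 h)]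
    exact (hX.mul_sub_le hv h).trans (le_abs_self _)

lemma abs_sub_le_mul (hv : IsVelocity vel L c Λ) (hX : IsCharacteristic vel W X) (s t : ℝ) :
    |X t - X s| ≤ Λ * |t - s| := by
  have hm := (hX.strictMono hv).monotone
  rcases le_total s t with h | h
  · rw [abs_of_nonneg (sub_nonneg.2 h), abs_of_nonneg (sub_nonneg.2 (hm h))]
    exact hX.sub_le_mul hv h
  · rw [abs_sub_comm t, abs_sub_comm (X t), abs_of_nonneg (sub_nonneg.2 h),
      abs_of_nonneg (sub_nonneg.2 (hm h))]
    exact hX.sub_le_mul hv h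

end IsCharacteristic

open Classical in
/-- The flow of the velocity field: `flow vel W t s x` is the position at time `t` of the
characteristic that is at `x` at time `s`. Such a characteristic exists and is unique for a
Lipschitz velocity and continuous `W`; the value `0` is a default for the other cases. -/
def flow (vel : ℝ → ℝ → ℝ) (W : ℝ → ℝ) (t s x : ℝ) : ℝ :=
  if h : ∃ X : ℝ → ℝ, X s = x ∧ IsCharacteristic vel W X then h.choose t else 0

section Flow

variable {vel : ℝ → ℝ → ℝ} {L c Λ : ℝ} {W : ℝ → ℝ}

lemma flow_self (hv : IsVelocity vel L c Λ) (hW : Continuous W) (s x : ℝ) :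
    flow vel W s s x = x := by
  have h := hv.exists_characteristic hW s x
  simp only [flow, dif_pos h]
  exact h.choose_spec.1

lemma isCharacteristic_flow (hv : IsVelocity vel L c Λ) (hW : Continuous W) (s x : ℝ) :
    IsCharacteristic vel W (fun t => flow vel W t s x) := by
  have h := hv.exists_characteristic hW s x
  simp only [flow, dif_pos h]
  exact h.choose_spec.2

lemma IsCharacteristic.flow_eq (hv : IsVelocity vel L c Λ) (hW : Continuous W) {X : ℝ → ℝ}
    (hX : IsCharacteristic vel W X) (s t : ℝ) : flow vel W t s (X s) = X t :=
  congrFun ((isCharacteristic_flow hv hW s (X s)).eq_of_eq hv hW hX (s := s)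
    (flow_self hv hW s _)) t

lemma flow_flow (hv : IsVelocity vel L c Λ) (hW : Continuous W) (t r s x : ℝ) :
    flow vel W t r (flow vel W r s x) = flow vel W t s x :=
  (isCharacteristic_flow hv hW s x).flow_eq hv hW r t

lemma flow_strictMono (hv : IsVelocity vel L c Λ) (hW : Continuous W) (t s : ℝ) :
    StrictMono (flow vel W t s) := fun x y hxy =>
  (isCharacteristic_flow hv hW s x).lt_of_lt hv hW (isCharacteristic_flow hv hW s y)
    (s := s) (by simpa only [flow_self hv hW] using hxy) t

lemma abs_flow_sub_flow_le (hv : IsVelocity vel L c Λ) (hW : Continuous W) (t s s' x x' : ℝ) :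
    |flow vel W t s x - flow vel W t s' x'| ≤
      Real.exp (L * |t - s|) * (|x - x'| + Λ * |s - s'|) := by
  refine ((isCharacteristic_flow hv hW s x).abs_sub_le_exp hv hW
    (isCharacteristic_flow hv hW s' x') s t).trans ?_
  gcongr
  rw [flow_self hv hW]
  have := (isCharacteristic_flow hv hW s' x').abs_sub_le_mul hv s' s
  rw [flow_self hv hW] at this
  rw [abs_sub_comm] at this
  exact (abs_sub_le _ x' _).trans (add_le_add le_rfl this)

lemma abs_sub_le_flow (hv : IsVelocity vel L c Λ) (hW : Continuous W) (t s x y : ℝ) :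
    |x - y| ≤ Real.exp (L * |t - s|) * |flow vel W t s x - flow vel W t s y| := by
  have := (isCharacteristic_flow hv hW s x).abs_sub_le_exp hv hW
    (isCharacteristic_flow hv hW s y) t s
  rwa [flow_self hv hW, flow_self hv hW, abs_sub_comm s] at this

lemma continuous_flow (hv : IsVelocity vel L c Λ) (hW : Continuous W) :
    Continuous fun z : ℝ × ℝ × ℝ => flow vel W z.1 z.2.1 z.2.2 := by
  refine continuous_iff_continuousAt.2 fun z => ?_
  refine tendsto_iff_dist_tendsto_zero.2 (squeeze_zero (fun _ => dist_nonneg) (g := fun y =>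
    Λ * |y.1 - z.1| + Real.exp (L * |z.1 - z.2.1|) *
      (|z.2.2 - y.2.2| + Λ * |z.2.1 - y.2.1|)) (fun y => ?_) ?_)
  · rw [Real.dist_eq]
    refine (abs_sub_le _ (flow vel W z.1 y.2.1 y.2.2) _).trans (add_le_add ?_ ?_)
    · exact (isCharacteristic_flow hv hW _ _).abs_sub_le_mul hv _ _
    · rw [abs_sub_comm]
      exact abs_flow_sub_flow_le hv hW _ _ _ _ _
  · exact Continuous.tendsto' (by fun_prop) _ _ (by simp)

end Flow

/-! ### The mass behind a characteristic, and the fixed point for the total mass -/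

/-- A normalised datum: a measurable function with values in `[0, K]` that vanishes outside
`(a, b)`. -/
structure IsDatum (a b K : ℝ) (f : ℝ → ℝ) : Prop where
  measurable : Measurable f
  nonneg : ∀ x, 0 ≤ f x
  le : ∀ x, f x ≤ K
  eq_zero : ∀ x ∉ Ioo a b, f x = 0

namespace IsDatum

variable {a b K : ℝ} {f : ℝ → ℝ}

lemma bound_nonneg (hf : IsDatum a b K f) : 0 ≤ K := (hf.nonneg 0).trans (hf.le 0)

lemma integrable (hf : IsDatum a b K f) : Integrable f := by
  have : IntegrableOn f (Ioo a b) := by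
    refine Measure.integrableOn_of_bounded (M := K) (by simp)
      hf.measurable.aestronglyMeasurable (Eventually.of_forall fun x => ?_)
    rw [Real.norm_eq_abs, abs_of_nonneg (hf.nonneg x)]
    exact hf.le x
  rwa [integrableOn_iff_integrable_of_support_subset] at this
  intro x hx
  by_contra h
  exact hx (hf.eq_zero x h)

lemma abs_setIntegral_sub_le (hf : IsDatum a b K f) {A B : Set ℝ} (hA : MeasurableSet A)
    (hB : MeasurableSet B) {r : ℝ} (hr : 0 ≤ r) (h : volume (A \ B) ≤ ENNReal.ofReal r)
    (h' : volume (B \ A) ≤ ENNReal.ofReal r) :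
    |(∫ x in A, f x) - ∫ x in B, f x| ≤ K * r := by
  have key : ∀ {A B : Set ℝ}, MeasurableSet A → MeasurableSet B →
      volume (A \ B) ≤ ENNReal.ofReal r → (∫ x in A, f x) - ∫ x in B, f x ≤ K * r := by
    intro A B hA hB h
    rw [← integral_inter_add_sdiff hB hf.integrable.integrableOn]
    have h1 : ∫ x in A ∩ B, f x ≤ ∫ x in B, f x :=
      setIntegral_mono_set hf.integrable.integrableOn (Eventually.of_forall hf.nonneg)
        inter_subset_right.eventuallyLE
    have hfin : volume (A \ B) < ∞ := h.trans_lt ENNReal.ofReal_lt_top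
    have h2 : ‖∫ x in A \ B, f x‖ ≤ K * volume.real (A \ B) := by
      refine norm_setIntegral_le_of_norm_le_const hfin fun x _ => ?_
      rw [Real.norm_eq_abs, abs_of_nonneg (hf.nonneg x)]
      exact hf.le x
    have h3 : volume.real (A \ B) ≤ r := ENNReal.toReal_le_of_le_ofReal hr h
    have h4 := mul_le_mul_of_nonneg_left h3 hf.bound_nonneg
    have h5 := (Real.le_norm_self _).trans h2
    linarith
  exact abs_sub_le_iff.2 ⟨key hA hB h, key hB hA h'⟩

end IsDatum

/-- The mass that at time `τ` lies to the left of `X τ` when the curve `X` is a characteristic: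
the initial mass to the left of `X 0`, and what enters through `x = 0` at times when `X` is
already inside. The data are understood to vanish outside `(0, 1)` and `(0, T)`, so that the first
term is zero when `X 0 ≤ 0`. -/
def massBehind (ρ₀ u : ℝ → ℝ) (τ : ℝ) (X : ℝ → ℝ) : ℝ :=
  (∫ x in Iio (X 0), ρ₀ x) + ∫ s in Ioo 0 τ ∩ {s | 0 < X s}, u s

/-- The total mass in `[0, 1]` at time `τ` of the solution driven by `W`: the mass behind the
characteristic that exits at time `τ`. -/
def massFunctional (vel : ℝ → ℝ → ℝ) (ρ₀ u W : ℝ → ℝ) (τ : ℝ) : ℝ :=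
  massBehind ρ₀ u τ (fun s => flow vel W s τ 1)

section MassBehind

variable {vel : ℝ → ℝ → ℝ} {L c Λ : ℝ} {W W₁ W₂ X Y : ℝ → ℝ} {T K τ τ' : ℝ} {ρ₀ u : ℝ → ℝ}

lemma massBehind_nonneg (hρ₀ : IsDatum 0 1 K ρ₀) (hu : IsDatum 0 T K u) (τ : ℝ) (X : ℝ → ℝ) :
    0 ≤ massBehind ρ₀ u τ X :=
  add_nonneg (integral_nonneg hρ₀.nonneg) (integral_nonneg hu.nonneg)

lemma massBehind_le (hρ₀ : IsDatum 0 1 K ρ₀) (hu : IsDatum 0 T K u) (τ : ℝ) (X : ℝ → ℝ) :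
    massBehind ρ₀ u τ X ≤ (∫ x, ρ₀ x) + ∫ s, u s :=
  add_le_add
    (setIntegral_le_integral hρ₀.integrable (Eventually.of_forall hρ₀.nonneg))
    (setIntegral_le_integral hu.integrable (Eventually.of_forall hu.nonneg))

/-- If two characteristics of possibly different `W` are `δ`-close on `[0, τ]`, their entrance
times through `x = 0` differ by at most `δ / c`. -/
lemma volume_pos_diff_pos_le (hv : IsVelocity vel L c Λ) (hY : IsCharacteristic vel W₂ Y)
    {δ : ℝ} (hXY : ∀ s ∈ Ioo 0 τ, |X s - Y s| ≤ δ) :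
    volume ((Ioo 0 τ ∩ {s | 0 < X s}) \ (Ioo 0 τ ∩ {s | 0 < Y s})) ≤ ENNReal.ofReal (δ / c) := by
  refine (Real.volume_le_diam _).trans (Metric.ediam_le ?_)
  have key : ∀ s ∈ (Ioo 0 τ ∩ {s | 0 < X s}) \ (Ioo 0 τ ∩ {s | 0 < Y s}),
      ∀ r ∈ (Ioo 0 τ ∩ {s | 0 < X s}) \ (Ioo 0 τ ∩ {s | 0 < Y s}), s ≤ r → r - s ≤ δ / c := by
    intro s hs r hr hsr
    rw [le_div_iff₀' hv.c_pos]
    have h1 := hY.mul_sub_le hv hsr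
    have h2 : Y r ≤ 0 := not_lt.1 fun h => hr.2 ⟨hr.1.1, h⟩
    have h3 : 0 < X s := hs.1.2
    have h4 := (le_abs_self _).trans (hXY s hs.1.1)
    linarith
  intro s hs r hr
  rw [edist_dist]
  refine ENNReal.ofReal_le_ofReal ?_
  rw [Real.dist_eq]
  rcases le_total s r with h | h
  · rw [abs_sub_comm, abs_of_nonneg (sub_nonneg.2 h)]
    exact key s hs r hr h
  · rw [abs_of_nonneg (sub_nonneg.2 h)]
    exact key r hr s hs h

lemma volume_Iio_diff_le (x y : ℝ) : volume (Iio x \ Iio y) ≤ ENNReal.ofReal |x - y| := by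
  refine (measure_mono (t := Icc y x) fun z hz => ⟨not_lt.1 hz.2, le_of_lt hz.1⟩).trans ?_
  rw [Real.volume_Icc]
  exact ENNReal.ofReal_le_ofReal (le_abs_self _)

lemma IsCharacteristic.measurableSet_pos (hX : IsCharacteristic vel W X) (τ : ℝ) :
    MeasurableSet (Ioo 0 τ ∩ {s | 0 < X s}) :=
  measurableSet_Ioo.inter (measurableSet_lt measurable_const hX.continuous.measurable)

lemma abs_massBehind_sub_le (hv : IsVelocity vel L c Λ) (hρ₀ : IsDatum 0 1 K ρ₀)
    (hu : IsDatum 0 T K u) (hX : IsCharacteristic vel W₁ X) (hY : IsCharacteristic vel W₂ Y)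
    (hτ : 0 ≤ τ) {δ : ℝ} (hXY : ∀ s ∈ Icc 0 τ, |X s - Y s| ≤ δ) :
    |massBehind ρ₀ u τ X - massBehind ρ₀ u τ Y| ≤ K * (1 + 1 / c) * δ := by
  have hδ : 0 ≤ δ := (abs_nonneg _).trans (hXY 0 ⟨le_rfl, hτ⟩)
  have h0 := hXY 0 ⟨le_rfl, hτ⟩
  have h1 : |(∫ x in Iio (X 0), ρ₀ x) - ∫ x in Iio (Y 0), ρ₀ x| ≤ K * δ := by
    refine hρ₀.abs_setIntegral_sub_le measurableSet_Iio measurableSet_Iio hδ ?_ ?_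
    · exact (volume_Iio_diff_le _ _).trans (ENNReal.ofReal_le_ofReal h0)
    · exact (volume_Iio_diff_le _ _).trans (ENNReal.ofReal_le_ofReal (by rwa [abs_sub_comm]))
  have h2 : |(∫ s in Ioo 0 τ ∩ {s | 0 < X s}, u s) - ∫ s in Ioo 0 τ ∩ {s | 0 < Y s}, u s| ≤
      K * (δ / c) := by
    refine hu.abs_setIntegral_sub_le (hX.measurableSet_pos _) (hY.measurableSet_pos _)
      (div_nonneg hδ hv.c_pos.le) ?_ ?_
    · exact volume_pos_diff_pos_le hv hY fun s hs => hXY s (Ioo_subset_Icc_self hs)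
    · exact volume_pos_diff_pos_le hv hX fun s hs =>
        abs_sub_comm (X s) _ ▸ hXY s (Ioo_subset_Icc_self hs)
  rw [massBehind, massBehind, add_sub_add_comm]
  refine (abs_add_le _ _).trans ((add_le_add h1 h2).trans_eq ?_)
  ring

lemma abs_massBehind_sub_time_le (hu : IsDatum 0 T K u) (hX : IsCharacteristic vel W X)
    (h : τ ≤ τ') : |massBehind ρ₀ u τ X - massBehind ρ₀ u τ' X| ≤ K * (τ' - τ) := by
  rw [massBehind, massBehind, add_sub_add_left_eq_sub]
  refine hu.abs_setIntegral_sub_le (hX.measurableSet_pos _) (hX.measurableSet_pos _)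
      (sub_nonneg.2 h) ?_ ?_
  · rw [sdiff_eq_empty.2 (inter_subset_inter_left _ (Ioo_subset_Ioo_right h))]
    simp
  · refine (measure_mono (t := Icc τ τ') fun s hs => ⟨?_, hs.1.1.2.le⟩).trans_eq
      Real.volume_Icc
    by_contra! hlt
    exact hs.2 ⟨⟨hs.1.1.1, hlt⟩, hs.1.2⟩

lemma continuousOn_massFunctional (hv : IsVelocity vel L c Λ) (hρ₀ : IsDatum 0 1 K ρ₀)
    (hu : IsDatum 0 T K u) (hW : Continuous W) :
    ContinuousOn (massFunctional vel ρ₀ u W) (Icc 0 T) := by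
  set C := K * (1 + 1 / c) * (Real.exp (L * T) * Λ) + K
  have key : ∀ τ ∈ Icc 0 T, ∀ τ' ∈ Icc 0 T, τ ≤ τ' →
      |massFunctional vel ρ₀ u W τ - massFunctional vel ρ₀ u W τ'| ≤ C * |τ - τ'| := by
    intro τ hτ τ' hτ' h
    have h1 : |massFunctional vel ρ₀ u W τ - massBehind ρ₀ u τ (fun s => flow vel W s τ' 1)| ≤
        K * (1 + 1 / c) * (Real.exp (L * T) * (Λ * |τ - τ'|)) := by
      refine abs_massBehind_sub_le hv hρ₀ hu (isCharacteristic_flow hv hW _ _)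
        (isCharacteristic_flow hv hW _ _) hτ.1 fun s hs => ?_
      refine (abs_flow_sub_flow_le hv hW s τ τ' 1 1).trans ?_
      rw [sub_self, abs_zero, zero_add]
      have := hv.Λ_pos
      have := hv.L_nonneg
      gcongr
      rw [abs_le]
      constructor <;> linarith [hs.1, hs.2, hτ.2]
    have h2 := abs_massBehind_sub_time_le (ρ₀ := ρ₀) hu (isCharacteristic_flow hv hW τ' 1) h
    refine (abs_sub_le _ _ _).trans ((add_le_add h1 h2).trans_eq ?_)
    rw [← abs_of_nonneg (sub_nonneg.2 h), abs_sub_comm τ']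
    ring
  have hC : 0 ≤ C := by
    have := hρ₀.bound_nonneg
    have := hv.Λ_pos
    have := hv.c_pos
    positivity
  refine (LipschitzOnWith.of_dist_le_mul (K := ⟨C, hC⟩) fun τ hτ τ' hτ' => ?_).continuousOn
  change |_| ≤ C * |_|
  rcases le_total τ τ' with h | h
  · exact key τ hτ τ' hτ' h
  · rw [abs_sub_comm, abs_sub_comm τ]
    exact key τ' hτ' τ hτ h

/-- The Volterra estimate: the change of the total mass at time `τ` is controlled by the change of
`W` before `τ`, because the two characteristics that exit at time `τ` separate only through the
difference of the velocities. -/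
lemma abs_massFunctional_sub_le (hv : IsVelocity vel L c Λ) (hρ₀ : IsDatum 0 1 K ρ₀)
    (hu : IsDatum 0 T K u) (hW₁ : Continuous W₁) (hW₂ : Continuous W₂) (hτ : τ ∈ Icc 0 T) :
    |massFunctional vel ρ₀ u W₁ τ - massFunctional vel ρ₀ u W₂ τ| ≤
      K * (1 + 1 / c) * (Real.exp (L * T) * L) * ∫ s in 0..τ, |W₁ s - W₂ s| := by
  rw [mul_assoc]
  refine abs_massBehind_sub_le hv hρ₀ hu (isCharacteristic_flow hv hW₁ _ _)
        (isCharacteristic_flow hv hW₂ _ _) hτ.1 fun s hs => ?_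
  refine (IsCharacteristic.abs_sub_le hv hW₁ hW₂ (isCharacteristic_flow hv hW₁ _ _)
    (isCharacteristic_flow hv hW₂ _ _) τ s).trans ?_
  rw [flow_self hv hW₁, flow_self hv hW₂, sub_self, abs_zero, zero_add, mul_assoc]
  have := hv.L_nonneg
  have h1 : |∫ r in τ..s, (|W₁ r - W₂ r|)| ≤ ∫ r in 0..τ, |W₁ r - W₂ r| := by
    rw [intervalIntegral.integral_symm, abs_neg, abs_of_nonneg
      (intervalIntegral.integral_nonneg hs.2 fun _ _ => abs_nonneg _)]
    have hint : ∀ a b, IntervalIntegrable (fun r => |W₁ r - W₂ r|) volume a b :=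
      fun a b => (by fun_prop : Continuous fun r => |W₁ r - W₂ r|).intervalIntegrable a b
    rw [← intervalIntegral.integral_add_adjacent_intervals (hint 0 s) (hint s τ)]
    linarith [intervalIntegral.integral_nonneg (f := fun r => |W₁ r - W₂ r|) (μ := volume) hs.1
      fun _ _ => abs_nonneg _]
  gcongr
  rw [abs_le]
  constructor <;> linarith [hs.1, hs.2, hτ.2]

end MassBehind

open scoped Nat in
/-- A map of Volterra type on `C([0, T])` has exactly one fixed point, because its iterates have
Lipschitz constants `(C T) ^ n / n!`. -/
theorem existsUnique_fixedPoint_of_volterra {T : ℝ} (hT : 0 ≤ T) {C : ℝ} (hC : 0 ≤ C)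
    (Φ : C(Icc (0 : ℝ) T, ℝ) → C(Icc (0 : ℝ) T, ℝ))
    (hΦ : ∀ w z, ∀ τ : Icc (0 : ℝ) T, |Φ w τ - Φ z τ| ≤
      C * ∫ s in (0 : ℝ)..τ, |IccExtend hT w s - IccExtend hT z s|) :
    ∃! w, Φ w = w := by
  have hcont : ∀ w : C(Icc (0 : ℝ) T, ℝ), Continuous (IccExtend hT w) := fun w =>
    w.continuous.Icc_extend'
  have hiter : ∀ n w z, ∀ τ : Icc (0 : ℝ) T,
      |Φ^[n] w τ - Φ^[n] z τ| ≤ (C * τ) ^ n / n ! * dist w z := by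
    intro n w z
    induction n with
    | zero =>
      intro τ
      simpa [Real.dist_eq] using ContinuousMap.dist_apply_le_dist (f := w) (g := z) τ
    | succ n ih =>
      intro τ
      rw [Function.iterate_succ_apply', Function.iterate_succ_apply']
      refine (hΦ _ _ τ).trans ?_
      have h1 : ∫ s in (0 : ℝ)..τ, |IccExtend hT (Φ^[n] w) s - IccExtend hT (Φ^[n] z) s| ≤
          ∫ s in (0 : ℝ)..τ, (C * s) ^ n / n ! * dist w z := by
        refine intervalIntegral.integral_mono_on τ.2.1
          (((hcont _).sub (hcont _)).abs.intervalIntegrable _ _)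
          ((by fun_prop : Continuous fun s : ℝ =>
            (C * s) ^ n / n ! * dist w z).intervalIntegrable _ _) fun s hs => ?_
        have hs' : s ∈ Icc 0 T := ⟨hs.1, hs.2.trans τ.2.2⟩
        rw [IccExtend_of_mem hT _ hs', IccExtend_of_mem hT _ hs']
        exact ih ⟨s, hs'⟩
      refine (mul_le_mul_of_nonneg_left h1 hC).trans_eq ?_
      simp_rw [mul_pow]
      rw [intervalIntegral.integral_mul_const, intervalIntegral.integral_div,
        intervalIntegral.integral_const_mul, integral_pow, Nat.factorial_succ]
      push_cast
      field_simp
      ring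
  obtain ⟨n, hn⟩ := (FloorSemiring.tendsto_pow_div_factorial_atTop (C * T)).eventually
    (gt_mem_nhds zero_lt_one) |>.exists
  have hnn : (0 : ℝ) ≤ (C * T) ^ n / n ! := by positivity
  have hcontr : ContractingWith ⟨_, hnn⟩ (Φ^[n]) := by
    refine ⟨hn, LipschitzWith.of_dist_le_mul fun w z => ?_⟩
    rw [ContinuousMap.dist_le (by positivity)]
    intro τ
    refine (hiter n w z τ).trans ?_
    change _ ≤ (C * T) ^ n / n ! * dist w z
    have := τ.2.1
    have := τ.2.2
    gcongr
  refine ⟨_, hcontr.isFixedPt_fixedPoint_iterate, fun w hw => ?_⟩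
  exact hcontr.fixedPoint_unique (Function.IsFixedPt.iterate hw n)

/-- There is exactly one continuous `w` on `[0, T]` that coincides with the total mass of the
solution driven by it. -/
theorem existsUnique_massFunctional_fixedPoint {vel : ℝ → ℝ → ℝ} {L c Λ T K : ℝ}
    {ρ₀ u : ℝ → ℝ} (hv : IsVelocity vel L c Λ) (hT : 0 ≤ T) (hρ₀ : IsDatum 0 1 K ρ₀)
    (hu : IsDatum 0 T K u) :
    ∃! w : C(Icc (0 : ℝ) T, ℝ),
      ∀ τ : Icc (0 : ℝ) T, massFunctional vel ρ₀ u (IccExtend hT w) τ = w τ := by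
  have hcont : ∀ w : C(Icc (0 : ℝ) T, ℝ), Continuous (IccExtend hT w) := fun w =>
    w.continuous.Icc_extend'
  have := existsUnique_fixedPoint_of_volterra hT (C := K * (1 + 1 / c) * (Real.exp (L * T) * L))
    (by have := hρ₀.bound_nonneg
        have := hv.L_nonneg
        have := hv.c_pos
        positivity)
    (fun w => ⟨fun τ => massFunctional vel ρ₀ u (IccExtend hT w) τ,
      (continuousOn_massFunctional hv hρ₀ hu (hcont w)).domRestrict⟩)
    (fun w z τ => abs_massFunctional_sub_le hv hρ₀ hu (hcont w) (hcont z) τ.2)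
  simp only [ContinuousMap.ext_iff] at this
  exact this

/-! ### The weak formulation up to the final time -/

/-- A function whose primitive vanishes is zero almost everywhere. -/
theorem ae_eq_zero_of_forall_intervalIntegral_eq_zero {f : ℝ → ℝ} {a b : ℝ} (hab : a ≤ b)
    (hf : IntervalIntegrable f volume a b) (h : ∀ y ∈ Icc a b, ∫ x in a..y, f x = 0) :
    ∀ᵐ x ∂(volume.restrict (Ioo a b)), f x = 0 := by
  rw [ae_restrict_iff' measurableSet_Ioo]
  filter_upwards [hf.ae_hasDerivAt_integral] with x hx hxI
  rw [uIcc_of_le hab] at hx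
  have h1 := hx (Ioo_subset_Icc_self hxI) a (left_mem_Icc.2 hab)
  have h2 : HasDerivAt (fun y => ∫ t in a..y, f t) 0 x := by
    refine (hasDerivAt_const x (0 : ℝ)).congr_of_eventuallyEq ?_
    filter_upwards [Ioo_mem_nhds hxI.1 hxI.2] with y hy
    exact h y (Ioo_subset_Icc_self hy)
  exact h1.unique h2

/-- Cauchy's formula for the twice iterated primitive. -/
theorem integral_sub_mul_eq_integral_integral {f : ℝ → ℝ} {σ : ℝ}
    (hf : IntervalIntegrable f volume 0 σ) :
    ∫ t in (0 : ℝ)..σ, (σ - t) * f t = ∫ t in (0 : ℝ)..σ, ∫ r in (0 : ℝ)..t, f r := by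
  have hE := hf.absolutelyContinuousOnInterval_intervalIntegral (c := 0) (by simp)
  have hlin : AbsolutelyContinuousOnInterval (fun t : ℝ => σ - t) 0 σ :=
    LipschitzOnWith.absolutelyContinuousOnInterval (K := 1)
      (LipschitzWith.of_dist_le_mul fun x y => by
        change |(σ - x) - (σ - y)| ≤ 1 * |x - y|
        rw [one_mul, sub_sub_sub_cancel_left, abs_sub_comm]).lipschitzOnWith
  have h := hlin.integral_mul_deriv_eq_deriv_mul hE
  simp only [sub_self, zero_mul, intervalIntegral.integral_same, mul_zero, zero_sub] at h
  have h1 : ∫ t in (0 : ℝ)..σ, (σ - t) * f t =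
      ∫ t in (0 : ℝ)..σ, (σ - t) * deriv (fun x => ∫ r in (0 : ℝ)..x, f r) t := by
    refine intervalIntegral.integral_congr_ae ?_
    filter_upwards [hf.ae_hasDerivAt_integral] with t ht htI
    rw [(ht (uIoc_subset_uIcc htI) 0 (by simp)).deriv]
  have h2 : ∀ t : ℝ, deriv (fun t : ℝ => σ - t) t = -1 := fun t => by
    simp
  rw [h1, h]
  simp_rw [h2]
  simp

lemma IntervalIntegrable.zero_one_iff {f : ℝ → ℝ} :
    IntervalIntegrable f volume 0 1 ↔ Integrable f (volume.restrict (Ioo 0 1)) := by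
  rw [intervalIntegrable_iff_integrableOn_Ioo_of_le zero_le_one, IntegrableOn]

lemma integral_zero_one {f : ℝ → ℝ} : ∫ x in (0 : ℝ)..1, f x = ∫ x in Ioo 0 1, f x := by
  rw [intervalIntegral.integral_of_le zero_le_one, integral_Ioc_eq_integral_Ioo]

section ContinuousInLp

variable {T : ℝ} {ρ : ℝ → ℝ → ℝ}

lemma ContinuousInLp.integrable (h : ContinuousInLp T 1 ρ) {t : ℝ} (ht : t ∈ Icc 0 T) :
    Integrable (ρ t) (volume.restrict (Ioo 0 1)) :=
  memLp_one_iff_integrable.1 (h.1 t ht)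

lemma ContinuousInLp.tendsto_integral_abs_sub (h : ContinuousInLp T 1 ρ) {t : ℝ}
    (ht : t ∈ Icc 0 T) :
    Tendsto (fun s => ∫ x in Ioo 0 1, |ρ s x - ρ t x|) (𝓝[Icc 0 T] t) (𝓝 0) := by
  have := (ENNReal.tendsto_toReal ENNReal.zero_ne_top).comp (h.2 t ht)
  rw [ENNReal.toReal_zero] at this
  refine this.congr' ?_
  filter_upwards [self_mem_nhdsWithin] with s hs
  have hi := (h.integrable hs).sub (h.integrable ht)
  rw [Function.comp_apply, eLpNorm_one_eq_lintegral_enorm]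
  exact (integral_norm_eq_lintegral_enorm hi.aestronglyMeasurable).symm

/-- Integrating an `L¹`-continuous curve against a continuous function gives a continuous
function of time. -/
lemma ContinuousInLp.continuousOn_integral_mul (h : ContinuousInLp T 1 ρ) {ψ : ℝ → ℝ → ℝ}
    (hψ : Continuous fun z : ℝ × ℝ => ψ z.1 z.2) :
    ContinuousOn (fun t => ∫ x in Ioo 0 1, ρ t x * ψ t x) (Icc 0 T) := by
  obtain ⟨M, hM⟩ := (isCompact_Icc (a := (0 : ℝ)) (b := T)).prod (isCompact_Icc (a := (0 : ℝ))
    (b := 1)) |>.exists_bound_of_continuousOn hψ.continuousOn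
  have hψx : ∀ t, Continuous (ψ t) := fun t => hψ.comp (by fun_prop : Continuous fun x => (t, x))
  have hψt : ∀ x, Continuous (fun t => ψ t x) := fun x =>
    hψ.comp (by fun_prop : Continuous fun t => (t, x))
  have hb : ∀ t ∈ Icc 0 T, ∀ᵐ x ∂(volume.restrict (Ioo 0 1)), ‖ψ t x‖ ≤ M := fun t ht => by
    filter_upwards [ae_restrict_mem measurableSet_Ioo] with x hx
    exact hM (t, x) ⟨ht, Ioo_subset_Icc_self hx⟩
  intro t ht
  have hM0 : 0 ≤ M := (norm_nonneg _).trans (hM (t, 0) ⟨ht, by simp⟩)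
  have h1 : Tendsto (fun s => ∫ x in Ioo 0 1, (ρ s x - ρ t x) * ψ s x) (𝓝[Icc 0 T] t) (𝓝 0) := by
    have h0 : Tendsto (fun s => (∫ x in Ioo 0 1, |ρ s x - ρ t x|) * M) (𝓝[Icc 0 T] t) (𝓝 0) := by
      simpa using (h.tendsto_integral_abs_sub ht).mul_const M
    refine squeeze_zero_norm' ?_ h0
    filter_upwards [self_mem_nhdsWithin] with s hs
    have hi := (h.integrable hs).sub (h.integrable ht)
    rw [← integral_mul_const]
    refine norm_integral_le_of_norm_le (hi.abs.mul_const M) ?_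
    filter_upwards [hb s hs] with x hx
    rw [norm_mul]
    exact mul_le_mul_of_nonneg_left hx (norm_nonneg _)
  have h2 : Tendsto (fun s => ∫ x in Ioo 0 1, ρ t x * ψ s x) (𝓝[Icc 0 T] t)
      (𝓝 (∫ x in Ioo 0 1, ρ t x * ψ t x)) := by
    refine tendsto_integral_filter_of_dominated_convergence (fun x => |ρ t x| * M) ?_ ?_
      ((h.integrable ht).abs.mul_const M) ?_
    · exact Eventually.of_forall fun s =>
        (h.integrable ht).aestronglyMeasurable.mul (hψx s).aestronglyMeasurable
    · filter_upwards [self_mem_nhdsWithin] with s hs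
      filter_upwards [hb s hs] with x hx
      rw [norm_mul]
      exact mul_le_mul_of_nonneg_left hx (norm_nonneg _)
    · exact Eventually.of_forall fun x =>
        (((hψt x).tendsto t).mono_left nhdsWithin_le_nhds).const_mul _
  have h3 := h1.add h2
  rw [zero_add] at h3
  refine h3.congr' ?_
  filter_upwards [self_mem_nhdsWithin] with s hs
  have e1 : Integrable (fun x => (ρ s x - ρ t x) * ψ s x) (volume.restrict (Ioo 0 1)) :=
    ((h.integrable hs).sub (h.integrable ht)).mul_bdd (hψx s).aestronglyMeasurable (hb s hs)
  have e2 : Integrable (fun x => ρ t x * ψ s x) (volume.restrict (Ioo 0 1)) :=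
    (h.integrable ht).mul_bdd (hψx s).aestronglyMeasurable (hb s hs)
  rw [← integral_add e1 e2]
  congr 1 with x
  ring

end ContinuousInLp

section WeakForm

variable {lam : ℝ → ℝ → ℝ} {T K : ℝ} {ρ₀ u : ℝ → ℝ} {ρ b : ℝ → ℝ → ℝ}

lemma IsWeakSolution.integrable_prod_mul (h : IsWeakSolution lam T ρ₀ u ρ) {G : ℝ → ℝ → ℝ}
    (hG : Continuous fun z : ℝ × ℝ => G z.1 z.2) :
    Integrable (fun z : ℝ × ℝ => ρ z.1 z.2 * G z.1 z.2)
      ((volume.restrict (Ioo 0 T)).prod (volume.restrict (Ioo 0 1))) := by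
  obtain ⟨M, hM⟩ := (isCompact_Icc (a := (0 : ℝ)) (b := T)).prod (isCompact_Icc (a := (0 : ℝ))
    (b := 1)) |>.exists_bound_of_continuousOn hG.continuousOn
  have hρ := h.memLinfty
  rw [Measure.volume_eq_prod, ← Measure.prod_restrict] at hρ
  refine (hρ.integrable le_top).mul_bdd (c := M) hG.aestronglyMeasurable ?_
  rw [Measure.prod_restrict]
  filter_upwards [ae_restrict_mem (measurableSet_Ioo.prod measurableSet_Ioo)] with z hz
  exact hM z ⟨Ioo_subset_Icc_self hz.1, Ioo_subset_Icc_self hz.2⟩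

/-- The weak formulation with a test function that need not vanish at the final time. It follows
from the test functions `(σ - t) ψ(t, x)`, `σ ≤ τ`, by differentiating twice in `σ`. -/
theorem IsWeakSolution.integral_eq (h : IsWeakSolution lam T ρ₀ u ρ)
    (hb : Continuous fun z : ℝ × ℝ => b z.1 z.2)
    (hlam : ∀ t ∈ Icc 0 T, ∀ x ∈ Icc (0 : ℝ) 1, lam x (totalMass ρ t) = b t x)
    (hu : IsDatum 0 T K u) {τ : ℝ} (hτ : 0 < τ) (hτT : τ ≤ T) {ψ ψt ψx : ℝ → ℝ → ℝ}
    (hψ : ContDiff ℝ 1 fun z : ℝ × ℝ => ψ z.1 z.2)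
    (hψt : ∀ t x, HasDerivAt (fun s => ψ s x) (ψt t x) t)
    (hψx : ∀ t x, HasDerivAt (fun y => ψ t y) (ψx t x) x)
    (hct : Continuous fun z : ℝ × ℝ => ψt z.1 z.2) (hcx : Continuous fun z : ℝ × ℝ => ψx z.1 z.2)
    (hψ1 : ∀ t ∈ Icc 0 τ, ψ t 1 = 0) {σ : ℝ} (hσ : σ ∈ Icc 0 τ) :
    ∫ x in Ioo 0 1, ρ σ x * ψ σ x =
      (∫ t in (0 : ℝ)..σ, ∫ x in Ioo 0 1, ρ t x * (ψt t x + b t x * ψx t x)) +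
      (∫ t in (0 : ℝ)..σ, u t * ψ t 0) + ∫ x in Ioo 0 1, ρ₀ x * ψ 0 x := by
  set A : ℝ → ℝ := fun t => ∫ x in Ioo 0 1, ρ t x * ψ t x with hAdef
  set B : ℝ → ℝ := fun t => ∫ x in Ioo 0 1, ρ t x * (ψt t x + b t x * ψx t x) with hBdef
  set D : ℝ := ∫ x in Ioo 0 1, ρ₀ x * ψ 0 x with hDdef
  have hG : Continuous fun z : ℝ × ℝ => ψt z.1 z.2 + b z.1 z.2 * ψx z.1 z.2 :=
    hct.add (hb.mul hcx)
  have hA : ContinuousOn A (Icc 0 T) := h.continuousInL1.continuousOn_integral_mul hψ.continuous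
  have hBi : IntervalIntegrable B volume 0 T := by
    rw [intervalIntegrable_iff_integrableOn_Ioo_of_le (hτ.le.trans hτT)]
    exact (h.integrable_prod_mul (G := fun t x => ψt t x + b t x * ψx t x) hG).integral_prod_left
  have hui : IntervalIntegrable (fun t => u t * ψ t 0) volume 0 T :=
    hu.integrable.intervalIntegrable.mul_continuousOn
      (hψ.continuous.comp (by fun_prop : Continuous fun t : ℝ => (t, (0 : ℝ)))).continuousOn
  have hsub : ∀ σ ∈ Icc 0 τ, uIcc 0 σ ⊆ uIcc 0 T := fun σ hσ => by
    rw [uIcc_of_le hσ.1, uIcc_of_le (hτ.le.trans hτT)]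
    exact Icc_subset_Icc_right (hσ.2.trans hτT)
  set f : ℝ → ℝ := fun t => B t + u t * ψ t 0
  have hf : IntervalIntegrable f volume 0 T := hBi.add hui
  have hslice : ∀ (t : ℝ) {g : ℝ → ℝ → ℝ}, (Continuous fun z : ℝ × ℝ => g z.1 z.2) →
      Continuous (g t) := fun t g hg => hg.comp (by fun_prop : Continuous fun x => (t, x))
  -- the weak formulation with the test function `(σ - t) ψ(t, x)`
  have hweak : ∀ σ ∈ Icc 0 τ, ∫ t in (0 : ℝ)..σ, A t =
      (∫ t in (0 : ℝ)..σ, (σ - t) * f t) + σ * D := by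
    intro σ hσ
    have hσT : σ ∈ Icc 0 T := ⟨hσ.1, hσ.2.trans hτT⟩
    have htest : IsTestFunction σ (fun t x => (σ - t) * ψ t x) := by
      refine ⟨?_, fun x _ => by simp, fun t ht => ?_⟩
      · exact ((contDiff_const.sub contDiff_fst).mul hψ).contDiffOn
      · simp [hψ1 t ⟨ht.1, ht.2.trans hσ.2⟩]
    have hw := h.weak_eq σ hσT _ htest
    have h1 : (∫ t in (0 : ℝ)..σ, ∫ x in (0 : ℝ)..1,
        ρ t x * (derivWithin (fun s => (σ - s) * ψ s x) (Icc 0 σ) t +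
          lam x (totalMass ρ t) * derivWithin (fun y => (σ - t) * ψ t y) (Icc 0 1) x)) =
        ∫ t in (0 : ℝ)..σ, (-A t + (σ - t) * B t) := by
      rw [intervalIntegral.integral_of_le hσ.1, intervalIntegral.integral_of_le hσ.1,
        integral_Ioc_eq_integral_Ioo, integral_Ioc_eq_integral_Ioo]
      refine setIntegral_congr_fun measurableSet_Ioo fun t ht => ?_
      have htT : t ∈ Icc 0 T := ⟨ht.1.le, ht.2.le.trans hσT.2⟩
      have hρt := IntervalIntegrable.zero_one_iff.2 (h.continuousInL1.integrable htT)
      have e1 : Integrable (fun x => ρ t x * ψ t x) (volume.restrict (Ioo 0 1)) :=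
        IntervalIntegrable.zero_one_iff.1
          (hρt.mul_continuousOn (hslice t hψ.continuous).continuousOn)
      have e2 : Integrable (fun x => ρ t x * (ψt t x + b t x * ψx t x))
          (volume.restrict (Ioo 0 1)) :=
        IntervalIntegrable.zero_one_iff.1 (hρt.mul_continuousOn
          (hslice t (g := fun t x => ψt t x + b t x * ψx t x) hG).continuousOn)
      have e3 : ∫ x in Ioo 0 1, (-(ρ t x * ψ t x) +
          (σ - t) * (ρ t x * (ψt t x + b t x * ψx t x))) = -A t + (σ - t) * B t := by
        have e1' : Integrable (fun x => -(ρ t x * ψ t x)) (volume.restrict (Ioo 0 1)) := e1.neg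
        rw [integral_add e1' (e2.const_mul _), integral_neg, integral_const_mul]
      rw [integral_zero_one, ← e3]
      refine setIntegral_congr_fun measurableSet_Ioo fun x hx => ?_
      have d1 : derivWithin (fun s => (σ - s) * ψ s x) (Icc 0 σ) t =
          -ψ t x + (σ - t) * ψt t x := by
        have : HasDerivAt (fun s => (σ - s) * ψ s x) (-1 * ψ t x + (σ - t) * ψt t x) t := by
          exact ((hasDerivAt_id t).const_sub σ).mul (hψt t x)
        rw [this.hasDerivWithinAt.derivWithin
          (uniqueDiffOn_Icc (ht.1.trans ht.2) t (Ioo_subset_Icc_self ht))]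
        ring
      have d2 : derivWithin (fun y => (σ - t) * ψ t y) (Icc 0 1) x = (σ - t) * ψx t x :=
        ((hψx t x).const_mul (σ - t)).hasDerivWithinAt.derivWithin
          (uniqueDiffOn_Icc zero_lt_one x (Ioo_subset_Icc_self hx))
      simp only [d1, d2, hlam t htT x (Ioo_subset_Icc_self hx)]
      ring
    rw [h1] at hw
    have iA : IntervalIntegrable A volume 0 σ := by
      refine ContinuousOn.intervalIntegrable (hA.mono ?_)
      rw [uIcc_of_le hσ.1]
      exact Icc_subset_Icc_right hσT.2
    have iB : IntervalIntegrable (fun t => (σ - t) * B t) volume 0 σ :=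
      (hBi.mono_set (hsub σ hσ)).continuousOn_mul (by fun_prop)
    have iu : IntervalIntegrable (fun t => (σ - t) * (u t * ψ t 0)) volume 0 σ :=
      (hui.mono_set (hsub σ hσ)).continuousOn_mul (by fun_prop)
    have h2 : (∫ t in (0 : ℝ)..σ, u t * ((σ - t) * ψ t 0)) =
        ∫ t in (0 : ℝ)..σ, (σ - t) * (u t * ψ t 0) :=
      intervalIntegral.integral_congr fun t _ => by ring
    have h3 : (∫ x in (0 : ℝ)..1, ρ₀ x * ((σ - 0) * ψ 0 x)) = σ * D := by
      rw [hDdef, ← integral_zero_one, ← intervalIntegral.integral_const_mul]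
      exact intervalIntegral.integral_congr fun t _ => by ring
    have iA' : IntervalIntegrable (fun t => -A t) volume 0 σ := iA.neg
    rw [h2, h3, intervalIntegral.integral_add iA' iB, intervalIntegral.integral_neg] at hw
    have h4 : ∫ t in (0 : ℝ)..σ, (σ - t) * f t =
        (∫ t in (0 : ℝ)..σ, (σ - t) * B t) + ∫ t in (0 : ℝ)..σ, (σ - t) * (u t * ψ t 0) := by
      rw [← intervalIntegral.integral_add iB iu]
      exact intervalIntegral.integral_congr fun t _ => by simp only [f]; ring
    linarith
  -- both sides of the claim are continuous in `σ` and have the same primitive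
  have hEc : ContinuousOn (fun s => (∫ t in (0 : ℝ)..s, f t) + D) (Icc 0 τ) := by
    have := intervalIntegral.continuousOn_primitive_interval' hf (left_mem_uIcc)
    rw [uIcc_of_le (hτ.le.trans hτT)] at this
    exact (this.mono (Icc_subset_Icc_right hτT)).add continuousOn_const
  have hAc : ContinuousOn A (Icc 0 τ) := hA.mono (Icc_subset_Icc_right hτT)
  have hae : ∀ᵐ s ∂(volume.restrict (Ioo 0 τ)), A s - ((∫ t in (0 : ℝ)..s, f t) + D) = 0 := by
    have hi : ∀ {g : ℝ → ℝ}, ContinuousOn g (Icc 0 τ) → ∀ σ ∈ Icc 0 τ,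
        IntervalIntegrable g volume 0 σ := fun {g} hg σ hσ =>
      ContinuousOn.intervalIntegrable (hg.mono (by
        rw [uIcc_of_le hσ.1]; exact Icc_subset_Icc_right hσ.2))
    refine ae_eq_zero_of_forall_intervalIntegral_eq_zero hτ.le
      (hi (hAc.sub hEc) τ ⟨hτ.le, le_rfl⟩) fun σ hσ => ?_
    have hE' : IntervalIntegrable (fun s => ∫ t in (0 : ℝ)..s, f t) volume 0 σ := by
      simpa using (hi hEc σ hσ).sub (_root_.intervalIntegrable_const (c := D))
    rw [intervalIntegral.integral_sub (hi hAc σ hσ) (hi hEc σ hσ), hweak σ hσ,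
      integral_sub_mul_eq_integral_integral (hf.mono_set (hsub σ hσ)),
      intervalIntegral.integral_add hE' _root_.intervalIntegrable_const]
    simp
  have heq : EqOn A (fun s => (∫ t in (0 : ℝ)..s, f t) + D) (Icc 0 τ) := by
    refine Measure.eqOn_Icc_of_ae_eq volume hτ.ne ?_ hAc hEc
    rw [← restrict_Ioo_eq_restrict_Icc]
    filter_upwards [hae] with s hs using sub_eq_zero.1 hs
  refine (heq hσ).trans ?_
  simp only [f]
  rw [intervalIntegral.integral_add (hBi.mono_set (hsub σ hσ)) (hui.mono_set (hsub σ hσ))]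

end WeakForm

/-! ### The mass formula for weak solutions, and uniqueness -/

lemma deriv_smoothTransition_eq_zero {r : ℝ} (hr : r ∉ Icc (0 : ℝ) 1) :
    deriv Real.smoothTransition r = 0 := by
  rw [mem_Icc, not_and_or, not_le, not_le] at hr
  rcases hr with hr | hr
  · have : Real.smoothTransition =ᶠ[𝓝 r] fun _ => 0 := by
      filter_upwards [Iio_mem_nhds hr] with s hs
      exact Real.smoothTransition.zero_of_nonpos (le_of_lt hs)
    rw [this.deriv_eq, deriv_const]
  · have : Real.smoothTransition =ᶠ[𝓝 r] fun _ => 1 := by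
      filter_upwards [Ioi_mem_nhds hr] with s hs
      exact Real.smoothTransition.one_of_one_le (le_of_lt hs)
    rw [this.deriv_eq, deriv_const]

lemma continuous_deriv_smoothTransition : Continuous (deriv Real.smoothTransition) :=
  (Real.smoothTransition.contDiff (n := 1)).continuous_deriv le_rfl

lemma exists_abs_deriv_smoothTransition_le :
    ∃ M, ∀ r, |deriv Real.smoothTransition r| ≤ M := by
  obtain ⟨M, hM⟩ := (isCompact_Icc (a := (0 : ℝ)) (b := 1)).exists_bound_of_continuousOn
    continuous_deriv_smoothTransition.continuousOn
  refine ⟨M, fun r => ?_⟩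
  by_cases hr : r ∈ Icc (0 : ℝ) 1
  · exact hM r hr
  · rw [deriv_smoothTransition_eq_zero hr, abs_zero]
    exact (norm_nonneg _).trans (hM 0 (by simp))

/-- Smooth approximations of the indicator function of `(0, ∞)`. -/
lemma tendsto_smoothTransition_mul_sub_one (r : ℝ) :
    Tendsto (fun n : ℕ => Real.smoothTransition (r * ((n : ℝ) + 1) - 1)) atTop
      (𝓝 ((Ioi (0 : ℝ)).indicator 1 r)) := by
  refine tendsto_const_nhds.congr' ?_
  by_cases hr : 0 < r
  · obtain ⟨m, hm⟩ := exists_nat_gt (2 / r)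
    filter_upwards [eventually_ge_atTop m] with n hn
    have hn' : (m : ℝ) ≤ n := by exact_mod_cast hn
    rw [indicator_of_mem (mem_Ioi.2 hr), Real.smoothTransition.one_of_one_le, Pi.one_apply]
    rw [div_lt_iff₀ hr] at hm
    nlinarith
  · refine Eventually.of_forall fun n => ?_
    rw [indicator_of_notMem (by simpa using hr)]
    have : (0 : ℝ) ≤ n := Nat.cast_nonneg n
    exact (Real.smoothTransition.zero_of_nonpos (by nlinarith)).symm

lemma setIntegral_mul_indicator_Ioi {f g : ℝ → ℝ} (hg : Measurable g) (s : Set ℝ) :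
    ∫ x in s, f x * (Ioi (0 : ℝ)).indicator 1 (g x) = ∫ x in s ∩ {x | 0 < g x}, f x := by
  rw [← setIntegral_indicator (measurableSet_lt measurable_const hg)]
  congr 1 with x
  by_cases h : 0 < g x <;> simp [h, indicator]

section MassFormula

variable {lam vel : ℝ → ℝ → ℝ} {L c Λ T K : ℝ} {ρ₀ u W X : ℝ → ℝ} {ρ : ℝ → ℝ → ℝ}

/-- The mass of a weak solution behind a characteristic is what was there initially plus what has
entered. The test functions are smooth cutoffs at the characteristic, on a length scale `1 / n`:
the error is controlled because the velocity is Lipschitz and vanishes as `n → ∞`. -/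
theorem IsWeakSolution.setIntegral_Iio_eq_massBehind (h : IsWeakSolution lam T ρ₀ u ρ)
    (hv : IsVelocity vel L c Λ) (hW : Continuous W)
    (hlam : ∀ t ∈ Icc 0 T, ∀ x ∈ Icc (0 : ℝ) 1, lam x (totalMass ρ t) = vel x (W t))
    (hT : 0 < T) (hρ₀ : IsDatum 0 1 K ρ₀) (hu : IsDatum 0 T K u)
    (hX : IsCharacteristic vel W X) {τ : ℝ} (hτ : τ ∈ Icc 0 T) (hXτ : X τ ≤ 1) :
    ∫ x in Ioo 0 1 ∩ Iio (X τ), ρ τ x = massBehind ρ₀ u τ X := by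
  obtain ⟨M, hM⟩ := exists_abs_deriv_smoothTransition_le
  have hM0 : 0 ≤ M := (abs_nonneg _).trans (hM 0)
  set S := Real.smoothTransition
  have hXc := hX.continuous
  have hvc := hv.continuous_uncurry
  have hScont : Continuous S := Real.smoothTransition.continuous
  have hS'cont : Continuous (deriv S) := continuous_deriv_smoothTransition
  have hXderiv : deriv X = fun t => vel (X t) (W t) := funext fun t => (hX t).deriv
  have hvX : Continuous fun t => vel (X t) (W t) := hvc.comp (hXc.prodMk hW)
  have hXC1 : ContDiff ℝ 1 X := contDiff_one_iff_deriv.2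
    ⟨fun t => (hX t).differentiableAt, by rwa [hXderiv]⟩
  have hb : Continuous fun z : ℝ × ℝ => vel z.2 (W z.1) :=
    hvc.comp (continuous_snd.prodMk (hW.comp continuous_fst))
  have hS : ∀ r, HasDerivAt S (deriv S r) r := fun r =>
    ((Real.smoothTransition.contDiff (n := 1)).differentiable one_ne_zero r).hasDerivAt
  set ψ : ℕ → ℝ → ℝ → ℝ := fun n t x => S ((X t - x) * ((n : ℝ) + 1) - 1) with hψdef
  set ψt : ℕ → ℝ → ℝ → ℝ := fun n t x =>
    deriv S ((X t - x) * ((n : ℝ) + 1) - 1) * (vel (X t) (W t) * ((n : ℝ) + 1))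
  set ψx : ℕ → ℝ → ℝ → ℝ := fun n t x =>
    deriv S ((X t - x) * ((n : ℝ) + 1) - 1) * (-1 * ((n : ℝ) + 1))
  have hψb : ∀ n t x, ‖ψ n t x‖ ≤ 1 := fun n t x => by
    rw [Real.norm_eq_abs, abs_of_nonneg (Real.smoothTransition.nonneg _)]
    exact Real.smoothTransition.le_one _
  have hψc : ∀ n, Continuous fun z : ℝ × ℝ => ψ n z.1 z.2 := fun n => by
    simp only [hψdef]; fun_prop
  have hslice : ∀ n t, Continuous (ψ n t) := fun n t =>
    (hψc n).comp (by fun_prop : Continuous fun x => (t, x))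
  -- the weak formulation for the cutoff functions
  have hint : ∀ n : ℕ, ∫ x in Ioo 0 1, ρ τ x * ψ n τ x =
      (∫ t in (0 : ℝ)..τ, ∫ x in Ioo 0 1, ρ t x * (ψt n t x + vel x (W t) * ψx n t x)) +
      (∫ t in (0 : ℝ)..τ, u t * ψ n t 0) + ∫ x in Ioo 0 1, ρ₀ x * ψ n 0 x := by
    intro n
    have hn : (0 : ℝ) < (n : ℝ) + 1 := by positivity
    have hΛ := hv.Λ_pos
    have hε : 0 < 1 / (((n : ℝ) + 1) * Λ) := by positivity
    -- The cutoff vanishes at `x = 1` while `X t ≤ 1 + 1 / (n + 1)`, hence for a little longer than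
    -- `τ`. The longer time interval is nondegenerate also for `τ = 0`.
    refine h.integral_eq (b := fun t x => vel x (W t)) (τ := min T (τ + 1 / (((n : ℝ) + 1) * Λ)))
      hb hlam hu (lt_min hT (by linarith [hτ.1])) (min_le_left _ _) (ψ := ψ n) ?_ ?_ ?_ ?_ ?_ ?_
      ⟨hτ.1, le_min hτ.2 (by linarith)⟩
    · refine (Real.smoothTransition.contDiff (n := 1)).comp ?_
      exact (((hXC1.comp contDiff_fst).sub contDiff_snd).mul contDiff_const).sub contDiff_const
    · intro t x
      exact (hS _).comp t ((((hX t).sub_const x).mul_const _).sub_const 1)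
    · intro t x
      exact (hS _).comp x ((((hasDerivAt_id x).const_sub (X t)).mul_const _).sub_const 1)
    · simp only [ψt]; fun_prop
    · simp only [ψx]; fun_prop
    · intro t ht
      refine Real.smoothTransition.zero_of_nonpos ?_
      have h1 : X t ≤ X (τ + 1 / (((n : ℝ) + 1) * Λ)) :=
        (hX.strictMono hv).monotone (ht.2.trans (min_le_right _ _))
      have h2 := hX.sub_le_mul hv (s := τ) (t := τ + 1 / (((n : ℝ) + 1) * Λ)) (by linarith)
      have h3 : Λ * (τ + 1 / (((n : ℝ) + 1) * Λ) - τ) = 1 / ((n : ℝ) + 1) := by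
        field_simp
        ring
      rw [h3] at h2
      have h4 : X t - 1 ≤ 1 / ((n : ℝ) + 1) := by linarith
      rw [le_div_iff₀ hn] at h4
      linarith
  -- the error term
  have herr_eq : ∀ n t x, ψt n t x + vel x (W t) * ψx n t x =
      deriv S ((X t - x) * ((n : ℝ) + 1) - 1) *
        ((vel (X t) (W t) - vel x (W t)) * ((n : ℝ) + 1)) := fun n t x => by
    simp only [ψt, ψx]; ring
  have herr_bd : ∀ n t x, ‖ψt n t x + vel x (W t) * ψx n t x‖ ≤ M * (L * 2) := by
    intro n t x
    have hL := hv.L_nonneg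
    rw [herr_eq, norm_mul, Real.norm_eq_abs, Real.norm_eq_abs]
    by_cases hr : (X t - x) * ((n : ℝ) + 1) - 1 ∈ Icc (0 : ℝ) 1
    · refine mul_le_mul (hM _) ?_ (abs_nonneg _) hM0
      have hn : (0 : ℝ) < (n : ℝ) + 1 := by positivity
      have h1 := hv.lipschitz (X t) x (W t) (W t)
      rw [sub_self (W t), abs_zero, add_zero] at h1
      rw [abs_mul, abs_of_pos hn]
      refine (mul_le_mul_of_nonneg_right h1 hn.le).trans ?_
      rw [mul_assoc]
      refine mul_le_mul_of_nonneg_left ?_ hL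
      rw [← abs_of_pos hn, ← abs_mul, abs_of_nonneg (by linarith [hr.1])]
      linarith [hr.2]
    · rw [deriv_smoothTransition_eq_zero hr, abs_zero, zero_mul]
      positivity
  have herr_lim : ∀ t x, Tendsto (fun n => ψt n t x + vel x (W t) * ψx n t x) atTop (𝓝 0) := by
    intro t x
    refine tendsto_const_nhds.congr' ?_
    suffices ∀ᶠ n : ℕ in atTop, (X t - x) * ((n : ℝ) + 1) - 1 ∉ Icc (0 : ℝ) 1 by
      filter_upwards [this] with n hn
      rw [herr_eq, deriv_smoothTransition_eq_zero hn, zero_mul]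
    by_cases hr : 0 < X t - x
    · obtain ⟨m, hm⟩ := exists_nat_gt (2 / (X t - x))
      filter_upwards [eventually_ge_atTop m] with n hn hmem
      have hn' : (m : ℝ) ≤ n := by exact_mod_cast hn
      rw [div_lt_iff₀ hr] at hm
      nlinarith [hmem.2]
    · refine Eventually.of_forall fun n hmem => ?_
      have : (0 : ℝ) ≤ n := Nat.cast_nonneg n
      nlinarith [hmem.1]
  have hgc : ∀ n, Continuous fun z : ℝ × ℝ => ψt n z.1 z.2 + vel z.2 (W z.1) * ψx n z.1 z.2 := by
    intro n
    simp only [ψt, ψx]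
    fun_prop
  have hlim1 : Tendsto (fun n => ∫ t in (0 : ℝ)..τ, ∫ x in Ioo 0 1,
      ρ t x * (ψt n t x + vel x (W t) * ψx n t x)) atTop (𝓝 0) := by
    have habs : ContinuousOn (fun t => ∫ x in Ioo 0 1, |ρ t x|) (Icc 0 T) := by
      intro t ht
      refine tendsto_iff_dist_tendsto_zero.2 (squeeze_zero' (Eventually.of_forall fun _ =>
        dist_nonneg) ?_ (h.continuousInL1.tendsto_integral_abs_sub ht))
      filter_upwards [self_mem_nhdsWithin] with s hs
      have i1 := h.continuousInL1.integrable hs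
      have i2 := h.continuousInL1.integrable ht
      rw [dist_eq_norm, ← integral_sub i1.abs i2.abs]
      refine norm_integral_le_of_norm_le (i1.sub i2).abs (Eventually.of_forall fun x => ?_)
      exact abs_abs_sub_abs_le_abs_sub _ _
    rw [show 𝓝 (0 : ℝ) = 𝓝 (∫ t in (0 : ℝ)..τ, (0 : ℝ)) by simp]
    refine intervalIntegral.tendsto_integral_filter_of_dominated_convergence
      (fun t => (∫ x in Ioo 0 1, |ρ t x|) * (M * (L * 2))) ?_ ?_ ?_ ?_
    · refine Eventually.of_forall fun n => ?_
      have := (h.integrable_prod_mul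
        (G := fun t x => ψt n t x + vel x (W t) * ψx n t x) (hgc n)).integral_prod_left
      rw [uIoc_of_le hτ.1, ← restrict_Ioo_eq_restrict_Ioc]
      exact (this.mono_measure (Measure.restrict_mono
        (Ioo_subset_Ioo_right hτ.2) le_rfl)).aestronglyMeasurable
    · refine Eventually.of_forall fun n => Eventually.of_forall fun t ht => ?_
      rw [uIoc_of_le hτ.1] at ht
      rw [← integral_mul_const]
      refine norm_integral_le_of_norm_le ((h.continuousInL1.integrable
        ⟨ht.1.le, ht.2.trans hτ.2⟩).abs.mul_const _) (Eventually.of_forall fun x => ?_)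
      rw [norm_mul]
      exact mul_le_mul_of_nonneg_left (herr_bd n t x) (norm_nonneg _)
    · refine ContinuousOn.intervalIntegrable ?_
      rw [uIcc_of_le hτ.1]
      exact (habs.mono (Icc_subset_Icc_right hτ.2)).mul continuousOn_const
    · refine Eventually.of_forall fun t ht => ?_
      rw [uIoc_of_le hτ.1] at ht
      have i1 := h.continuousInL1.integrable ⟨ht.1.le, ht.2.trans hτ.2⟩
      rw [show 𝓝 (0 : ℝ) = 𝓝 (∫ x in Ioo (0 : ℝ) 1, (0 : ℝ)) by simp]
      refine tendsto_integral_of_dominated_convergence (fun x => |ρ t x| * (M * (L * 2)))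
        (fun n => ?_) (i1.abs.mul_const _) (fun n => Eventually.of_forall fun x => ?_)
        (Eventually.of_forall fun x => ?_)
      · exact i1.aestronglyMeasurable.mul
          ((hgc n).comp (by fun_prop : Continuous fun x => (t, x))).aestronglyMeasurable
      · rw [norm_mul]
        exact mul_le_mul_of_nonneg_left (herr_bd n t x) (norm_nonneg _)
      · simpa using (herr_lim t x).const_mul (ρ t x)
  -- the remaining terms
  have hlim : ∀ {f : ℝ → ℝ} {s : Set ℝ} {g : ℕ → ℝ → ℝ} {r : ℝ → ℝ},
      Integrable f (volume.restrict s) → (∀ n, Continuous (g n)) → Continuous r →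
      (∀ n x, g n x = S (r x * ((n : ℝ) + 1) - 1)) →
      Tendsto (fun n => ∫ x in s, f x * g n x) atTop (𝓝 (∫ x in s ∩ {x | 0 < r x}, f x)) := by
    intro f s g r hf hg hr hgr
    rw [← setIntegral_mul_indicator_Ioi hr.measurable]
    refine tendsto_integral_of_dominated_convergence (fun x => |f x|)
      (fun n => hf.aestronglyMeasurable.mul (hg n).aestronglyMeasurable) hf.abs
      (fun n => Eventually.of_forall fun x => ?_) (Eventually.of_forall fun x => ?_)
    · rw [norm_mul]
      refine mul_le_of_le_one_right (norm_nonneg _) ?_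
      rw [hgr, Real.norm_eq_abs, abs_of_nonneg (Real.smoothTransition.nonneg _)]
      exact Real.smoothTransition.le_one _
    · simp only [hgr]
      exact (tendsto_smoothTransition_mul_sub_one (r x)).const_mul _
  have hl0 := hlim (h.continuousInL1.integrable hτ) (fun n => hslice n τ)
    (by fun_prop : Continuous fun x => X τ - x) (fun n x => rfl)
  have hl3 := hlim hρ₀.integrable.integrableOn (s := Ioo 0 1) (fun n => hslice n 0)
    (by fun_prop : Continuous fun x => X 0 - x) (fun n x => rfl)
  have hl2 := hlim hu.integrable.integrableOn (s := Ioo 0 τ) (g := fun n t => ψ n t 0)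
    (fun n => (hψc n).comp (by fun_prop : Continuous fun t => (t, (0 : ℝ)))) hXc
    (fun n x => by simp only [hψdef, sub_zero])
  have hr := (hlim1.add hl2).add hl3
  have hlhs : Tendsto (fun n => ∫ x in Ioo 0 1, ρ τ x * ψ n τ x) atTop
      (𝓝 (0 + (∫ x in Ioo 0 τ ∩ {x | 0 < X x}, u x) +
        ∫ x in Ioo 0 1 ∩ {x | 0 < X 0 - x}, ρ₀ x)) := by
    refine hr.congr fun n => ?_
    rw [hint n, intervalIntegral.integral_of_le hτ.1, intervalIntegral.integral_of_le hτ.1,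
      integral_Ioc_eq_integral_Ioo, integral_Ioc_eq_integral_Ioo]
  have hset : ∀ y : ℝ, {x | 0 < y - x} = Iio y := fun y => by ext x; simp
  rw [hset] at hl0 hlhs
  rw [tendsto_nhds_unique hl0 hlhs, massBehind, zero_add, add_comm]
  congr 1
  refine (setIntegral_eq_of_subset_of_forall_sdiff_eq_zero measurableSet_Iio inter_subset_right
    fun x hx => hρ₀.eq_zero x fun hx' => hx.2 ⟨hx', hx.1⟩).symm

end MassFormula

/-- A velocity on `[0, 1] × [0, ∞)` that is `C¹` and positive extends from `[0, 1] × [0, B]` to a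
Lipschitz velocity field on the plane, by clamping the arguments. -/
theorem exists_isVelocity_eqOn {lam : ℝ → ℝ → ℝ}
    (hlam_C1 : ContDiffOn ℝ 1 (fun z : ℝ × ℝ => lam z.1 z.2) (Icc 0 1 ×ˢ Ici 0))
    (hlam_pos : ∀ x ∈ Icc (0 : ℝ) 1, ∀ W ∈ Ici (0 : ℝ), 0 < lam x W) {B : ℝ} (hB : 0 < B) :
    ∃ vel L c Λ, IsVelocity vel L c Λ ∧
      ∀ x ∈ Icc (0 : ℝ) 1, ∀ w ∈ Icc 0 B, lam x w = vel x w := by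
  set Q : Set (ℝ × ℝ) := Icc 0 1 ×ˢ Icc 0 B
  have hQ : Q ⊆ Icc 0 1 ×ˢ Ici 0 := prod_mono le_rfl Icc_subset_Ici_self
  have hQc : IsCompact Q := isCompact_Icc.prod isCompact_Icc
  have hC1 := hlam_C1.mono hQ
  have hcont := hC1.continuousOn
  have hud : UniqueDiffOn ℝ Q := (uniqueDiffOn_Icc zero_lt_one).prod (uniqueDiffOn_Icc hB)
  obtain ⟨L, hL⟩ := hQc.exists_bound_of_continuousOn (hC1.continuousOn_fderivWithin hud le_rfl)
  obtain ⟨Λ, hΛ⟩ := hQc.exists_bound_of_continuousOn hcont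
  have h0 : ((0 : ℝ), (0 : ℝ)) ∈ Q := ⟨by simp, by simp [hB.le]⟩
  have hL0 : 0 ≤ L := (norm_nonneg _).trans (hL _ h0)
  obtain ⟨z, hz, hmin⟩ := hQc.exists_isMinOn ⟨_, h0⟩ hcont
  have hmem : ∀ x w, ((projIcc (0 : ℝ) 1 zero_le_one x : ℝ), (projIcc 0 B hB.le w : ℝ)) ∈ Q :=
    fun x w => ⟨Subtype.prop _, Subtype.prop _⟩
  refine ⟨fun x w => lam (projIcc 0 1 zero_le_one x) (projIcc 0 B hB.le w), L, lam z.1 z.2, Λ,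
    ⟨hL0, hlam_pos _ (hQ hz).1 _ (hQ hz).2, fun x y w w' => ?_, fun x w => hmin (hmem x w),
      fun x w => (le_abs_self _).trans (hΛ _ (hmem x w))⟩, fun x hx w hw => ?_⟩
  · have hconv : Convex ℝ Q := (convex_Icc (0 : ℝ) 1).prod (convex_Icc 0 B)
    have hlip := hconv.norm_image_sub_le_of_norm_fderivWithin_le
      (hC1.differentiableOn one_ne_zero) hL (hmem y w') (hmem x w)
    refine hlip.trans (mul_le_mul_of_nonneg_left ?_ hL0)
    rw [Prod.norm_def]
    have h1 : |(projIcc (0 : ℝ) 1 zero_le_one x : ℝ) - projIcc (0 : ℝ) 1 zero_le_one y| ≤ |x - y| :=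
      abs_projIcc_sub_projIcc _
    have h2 : |(projIcc 0 B hB.le w : ℝ) - projIcc 0 B hB.le w'| ≤ |w - w'| :=
      abs_projIcc_sub_projIcc _
    refine max_le ?_ ?_
    · exact h1.trans (le_add_of_nonneg_right (abs_nonneg _))
    · exact h2.trans (le_add_of_nonneg_left (abs_nonneg _))
  · simp only
    rw [projIcc_of_mem _ hx, projIcc_of_mem _ hw]

section Uniqueness

variable {lam : ℝ → ℝ → ℝ} {T K : ℝ} {ρ₀ u : ℝ → ℝ} {ρ ρ' : ℝ → ℝ → ℝ}

lemma ContinuousInLp.continuousOn_totalMass (h : ContinuousInLp T 1 ρ) :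
    ContinuousOn (totalMass ρ) (Icc 0 T) := by
  have := h.continuousOn_integral_mul (ψ := fun _ _ => 1) continuous_const
  simp only [mul_one, ← integral_zero_one] at this
  exact this

/-- Two weak solutions coincide: both total masses solve the same fixed point equation, hence
they agree, and then the primitives of both solutions are given by the same characteristics. -/
theorem IsWeakSolution.ae_eq
    (hlam_C1 : ContDiffOn ℝ 1 (fun z : ℝ × ℝ => lam z.1 z.2) (Icc 0 1 ×ˢ Ici 0))
    (hlam_pos : ∀ x ∈ Icc (0 : ℝ) 1, ∀ W ∈ Ici (0 : ℝ), 0 < lam x W) (hT : 0 < T)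
    (hρ₀ : IsDatum 0 1 K ρ₀) (hu : IsDatum 0 T K u) (h : IsWeakSolution lam T ρ₀ u ρ)
    (h' : IsWeakSolution lam T ρ₀ u ρ') {t : ℝ} (ht : t ∈ Icc 0 T) :
    ρ' t =ᵐ[volume.restrict (Ioo 0 1)] ρ t := by
  have hc := h.continuousInL1.continuousOn_totalMass
  have hc' := h'.continuousInL1.continuousOn_totalMass
  obtain ⟨B₁, hB₁⟩ := isCompact_Icc.exists_bound_of_continuousOn hc
  obtain ⟨B₂, hB₂⟩ := isCompact_Icc.exists_bound_of_continuousOn hc'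
  set B := max 1 (max B₁ B₂)
  obtain ⟨vel, L, c, Λ, hv, hvel⟩ := exists_isVelocity_eqOn hlam_C1 hlam_pos (B := B)
    (zero_lt_one.trans_le (le_max_left _ _))
  have hbd : ∀ s ∈ Icc 0 T, totalMass ρ s ∈ Icc 0 B := fun s hs =>
    ⟨h.mass_nonneg s hs, (le_abs_self _).trans ((hB₁ s hs).trans
      ((le_max_left _ _).trans (le_max_right _ _)))⟩
  have hbd' : ∀ s ∈ Icc 0 T, totalMass ρ' s ∈ Icc 0 B := fun s hs =>
    ⟨h'.mass_nonneg s hs, (le_abs_self _).trans ((hB₂ s hs).trans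
      ((le_max_right _ _).trans (le_max_right _ _)))⟩
  have key : ∀ {ρ : ℝ → ℝ → ℝ}, IsWeakSolution lam T ρ₀ u ρ →
      (∀ s ∈ Icc 0 T, totalMass ρ s ∈ Icc 0 B) → ∀ w : C(Icc (0 : ℝ) T, ℝ),
      (∀ s : Icc (0 : ℝ) T, w s = totalMass ρ s) →
      (∀ τ : Icc (0 : ℝ) T, massFunctional vel ρ₀ u (IccExtend hT.le w) τ = w τ) ∧
      ∀ y ≤ 1, ∫ x in Ioo 0 1 ∩ Iio y, ρ t x =
        massBehind ρ₀ u t (fun s => flow vel (IccExtend hT.le w) s t y) := by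
    intro ρ h hbd w hw
    have hWc : Continuous (IccExtend hT.le w) := w.continuous.Icc_extend'
    have hlam : ∀ s ∈ Icc 0 T, ∀ x ∈ Icc (0 : ℝ) 1,
        lam x (totalMass ρ s) = vel x (IccExtend hT.le w s) := fun s hs x hx => by
      rw [IccExtend_of_mem _ _ hs, hw]
      exact hvel x hx _ (hbd s hs)
    have hmass : ∀ τ ∈ Icc 0 T, ∀ y ≤ 1, ∫ x in Ioo 0 1 ∩ Iio y, ρ τ x =
        massBehind ρ₀ u τ (fun s => flow vel (IccExtend hT.le w) s τ y) := by
      intro τ hτ y hy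
      have := h.setIntegral_Iio_eq_massBehind hv hWc hlam hT hρ₀ hu
        (isCharacteristic_flow hv hWc τ y) hτ
      simp only [flow_self hv hWc] at this
      exact this hy
    refine ⟨fun τ => ?_, hmass t ht⟩
    rw [hw, massFunctional, ← hmass τ τ.2 1 le_rfl, totalMass, integral_zero_one,
      inter_eq_left.2 Ioo_subset_Iio_self]
  obtain ⟨hfix, hprim⟩ := key h hbd ⟨fun s => totalMass ρ s, hc.domRestrict⟩ fun _ => rfl
  obtain ⟨hfix', hprim'⟩ := key h' hbd' ⟨fun s => totalMass ρ' s, hc'.domRestrict⟩ fun _ => rfl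
  have hww := (existsUnique_massFunctional_fixedPoint hv hT.le hρ₀ hu).unique hfix hfix'
  have i1 := h.continuousInL1.integrable ht
  have i2 := h'.continuousInL1.integrable ht
  have hzero := ae_eq_zero_of_forall_intervalIntegral_eq_zero (f := fun x => ρ' t x - ρ t x)
    zero_le_one (IntervalIntegrable.zero_one_iff.2 (i2.sub i1)) fun y hy => by
      have hprimitive : ∀ f : ℝ → ℝ, ∫ x in (0 : ℝ)..y, f x = ∫ x in Ioo 0 1 ∩ Iio y, f x := by
        intro f
        rw [intervalIntegral.integral_of_le hy.1, integral_Ioc_eq_integral_Ioo]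
        congr 2
        ext x
        simp only [mem_Ioo, mem_inter_iff, mem_Iio]
        exact ⟨fun hx => ⟨⟨hx.1, hx.2.trans_le hy.2⟩, hx.2⟩, fun hx => ⟨hx.1.1, hx.2⟩⟩
      rw [hprimitive,
        integral_sub (i2.mono_measure (Measure.restrict_mono inter_subset_left le_rfl))
        (i1.mono_measure (Measure.restrict_mono inter_subset_left le_rfl)), hprim y hy.2,
        hprim' y hy.2, hww, sub_self]
  filter_upwards [hzero] with x hx using sub_eq_zero.1 hx

end Uniqueness

/-! ### Transported measures and their densities -/

/-- A map that expands distances on `S` at least by the factor `1 / C` increases the volume of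
preimages in `S` at most by the factor `C`. -/
theorem volume_inter_preimage_le {f : ℝ → ℝ} {S : Set ℝ} {C : ℝ} (hC : 0 ≤ C)
    (hf : ∀ x ∈ S, ∀ y ∈ S, |x - y| ≤ C * |f x - f y|) (A : Set ℝ) :
    volume (S ∩ f ⁻¹' A) ≤ ENNReal.ofReal C * volume A := by
  have hinj : InjOn f S := fun x hx y hy hxy => by
    have := hf x hx y hy
    rw [hxy, sub_self, abs_zero, mul_zero] at this
    exact sub_eq_zero.1 (abs_nonpos_iff.1 this)
  have hlip : LipschitzOnWith ⟨C, hC⟩ (Function.invFunOn f S) (f '' S ∩ A) := by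
    refine LipschitzOnWith.of_dist_le_mul ?_
    rintro _ ⟨⟨x, hx, rfl⟩, -⟩ _ ⟨⟨y, hy, rfl⟩, -⟩
    rw [hinj.leftInvOn_invFunOn hx, hinj.leftInvOn_invFunOn hy]
    exact hf x hx y hy
  have hsub : S ∩ f ⁻¹' A ⊆ Function.invFunOn f S '' (f '' S ∩ A) := fun x hx =>
    ⟨f x, ⟨mem_image_of_mem f hx.1, hx.2⟩, hinj.leftInvOn_invFunOn hx.1⟩
  have h := hlip.hausdorffMeasure_image_le (d := 1) zero_le_one
  rw [hausdorffMeasure_real, ENNReal.rpow_one] at h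
  refine (measure_mono hsub).trans (h.trans ?_)
  rw [ENNReal.ofReal, Real.toNNReal_of_nonneg hC]
  exact mul_le_mul_right (measure_mono inter_subset_right) _

/-- The measure with density `f` with respect to Lebesgue measure. -/
def datumMeasure (f : ℝ → ℝ) : Measure ℝ := volume.withDensity fun x => ENNReal.ofReal (f x)

namespace IsDatum

variable {a b K : ℝ} {f : ℝ → ℝ}

lemma isFiniteMeasure (hf : IsDatum a b K f) : IsFiniteMeasure (datumMeasure f) :=
  isFiniteMeasure_withDensity_ofReal hf.integrable.2

lemma measureReal_apply (hf : IsDatum a b K f) {A : Set ℝ} (hA : MeasurableSet A) :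
    (datumMeasure f).real A = ∫ x in A, f x := by
  rw [measureReal_def, datumMeasure, withDensity_apply _ hA,
    integral_eq_lintegral_of_nonneg_ae (Eventually.of_forall hf.nonneg)
      hf.measurable.aestronglyMeasurable]

lemma integral_eq (hf : IsDatum a b K f) (g : ℝ → ℝ) :
    ∫ x, g x ∂(datumMeasure f) = ∫ x, f x * g x := by
  rw [datumMeasure, integral_withDensity_eq_integral_toReal_smul
    hf.measurable.ennreal_ofReal (Eventually.of_forall fun x => ENNReal.ofReal_lt_top)]
  congr 1 with x
  rw [ENNReal.toReal_ofReal (hf.nonneg x), smul_eq_mul]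

lemma map_le (hf : IsDatum a b K f) {g : ℝ → ℝ} (hg : Measurable g) {C : ℝ} (hC : 0 ≤ C)
    (hgC : ∀ x ∈ Ioo a b, ∀ y ∈ Ioo a b, |x - y| ≤ C * |g x - g y|) :
    (datumMeasure f).map g ≤ ENNReal.ofReal (K * C) • volume := by
  refine Measure.le_iff.2 fun A hA => ?_
  rw [Measure.map_apply hg hA, datumMeasure, withDensity_apply _ (hg hA)]
  have h1 : ∫⁻ x in g ⁻¹' A, ENNReal.ofReal (f x) ≤
      ∫⁻ x in g ⁻¹' A, (Ioo a b).indicator (fun _ => ENNReal.ofReal K) x := by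
    refine lintegral_mono fun x => ?_
    by_cases hx : x ∈ Ioo a b
    · rw [indicator_of_mem hx]
      exact ENNReal.ofReal_le_ofReal (hf.le x)
    · rw [indicator_of_notMem hx, hf.eq_zero x hx, ENNReal.ofReal_zero]
  refine h1.trans ?_
  rw [lintegral_indicator measurableSet_Ioo, lintegral_const, Measure.restrict_apply_univ,
    Measure.restrict_apply measurableSet_Ioo, Measure.smul_apply, smul_eq_mul,
    ENNReal.ofReal_mul hf.bound_nonneg, mul_assoc]
  exact mul_le_mul_right (volume_inter_preimage_le hC hgC A) _

end IsDatum

/-- The distribution of mass at time `t` on the whole line: the initial mass has been moved by the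
flow, and the mass that enters at time `s` is carried by the characteristic through `(s, 0)`.
Mass that has not yet entered lies to the left of `0`, mass that has left to the right of `1`. -/
def massAt (vel : ℝ → ℝ → ℝ) (ρ₀ u W : ℝ → ℝ) (t : ℝ) : Measure ℝ :=
  (datumMeasure ρ₀).map (fun x => flow vel W t 0 x) +
    (datumMeasure u).map (fun s => flow vel W t s 0)

section MassAt

variable {vel : ℝ → ℝ → ℝ} {L c Λ T K : ℝ} {ρ₀ u W : ℝ → ℝ}

lemma measurable_flow_position (hv : IsVelocity vel L c Λ) (hW : Continuous W) (t s : ℝ) :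
    Measurable fun x => flow vel W t s x :=
  ((continuous_flow hv hW).comp (by fun_prop : Continuous fun x : ℝ => (t, s, x))).measurable

lemma measurable_flow_start (hv : IsVelocity vel L c Λ) (hW : Continuous W) (t x : ℝ) :
    Measurable fun s => flow vel W t s x :=
  ((continuous_flow hv hW).comp (by fun_prop : Continuous fun s : ℝ => (t, s, x))).measurable

lemma massAt_apply (hv : IsVelocity vel L c Λ) (hW : Continuous W) (t : ℝ) {A : Set ℝ}
    (hA : MeasurableSet A) :
    massAt vel ρ₀ u W t A = datumMeasure ρ₀ {x | flow vel W t 0 x ∈ A} +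
      datumMeasure u {s | flow vel W t s 0 ∈ A} := by
  rw [massAt, Measure.add_apply, Measure.map_apply (measurable_flow_position hv hW t 0) hA,
    Measure.map_apply (measurable_flow_start hv hW t 0) hA]
  rfl

lemma massAt_univ (hv : IsVelocity vel L c Λ) (hW : Continuous W) (t : ℝ) :
    massAt vel ρ₀ u W t univ = datumMeasure ρ₀ univ + datumMeasure u univ := by
  simp [massAt_apply hv hW t MeasurableSet.univ]

lemma isFiniteMeasure_massAt (hv : IsVelocity vel L c Λ) (hW : Continuous W)
    (hρ₀ : IsDatum 0 1 K ρ₀) (hu : IsDatum 0 T K u) (t : ℝ) :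
    IsFiniteMeasure (massAt vel ρ₀ u W t) := by
  have := hρ₀.isFiniteMeasure
  have := hu.isFiniteMeasure
  exact ⟨by rw [massAt_univ hv hW]; exact ENNReal.add_lt_top.2 ⟨measure_lt_top _ _,
    measure_lt_top _ _⟩⟩

lemma measurable_massAt (hv : IsVelocity vel L c Λ) (hW : Continuous W)
    (hρ₀ : IsDatum 0 1 K ρ₀) (hu : IsDatum 0 T K u) : Measurable (massAt vel ρ₀ u W) := by
  have := hρ₀.isFiniteMeasure
  have := hu.isFiniteMeasure
  refine Measure.measurable_of_measurable_coe _ fun A hA => ?_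
  simp_rw [massAt_apply hv hW _ hA]
  have h1 : Measurable fun z : ℝ × ℝ => flow vel W z.1 0 z.2 :=
    ((continuous_flow hv hW).comp
      (by fun_prop : Continuous fun z : ℝ × ℝ => (z.1, (0 : ℝ), z.2))).measurable
  have h2 : Measurable fun z : ℝ × ℝ => flow vel W z.1 z.2 0 :=
    ((continuous_flow hv hW).comp
      (by fun_prop : Continuous fun z : ℝ × ℝ => (z.1, z.2, (0 : ℝ)))).measurable
  exact (measurable_measure_prodMk_left (h1 hA)).add (measurable_measure_prodMk_left (h2 hA))

lemma map_flow_massAt (hv : IsVelocity vel L c Λ) (hW : Continuous W) (s t : ℝ) :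
    (massAt vel ρ₀ u W s).map (fun x => flow vel W t s x) = massAt vel ρ₀ u W t := by
  have h := measurable_flow_position hv hW t s
  rw [massAt, Measure.map_add _ _ h, Measure.map_map h (measurable_flow_position hv hW s 0),
    Measure.map_map h (measurable_flow_start hv hW s 0), massAt]
  simp only [Function.comp_def, flow_flow hv hW]

/-- The transported mass has bounded density: the flow contracts distances at most by the factor
`exp (-L T)`, and mass elements that enter at times `s` and `r` are at distance at least
`c |s - r|` when the second of them enters. -/
lemma massAt_le (hv : IsVelocity vel L c Λ) (hW : Continuous W) (hρ₀ : IsDatum 0 1 K ρ₀)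
    (hu : IsDatum 0 T K u) {t : ℝ} (ht : t ∈ Icc 0 T) :
    massAt vel ρ₀ u W t ≤
      ENNReal.ofReal (K * Real.exp (L * T) + K * (Real.exp (L * T) / c)) • volume := by
  have hL := hv.L_nonneg
  have hc := hv.c_pos
  have hexp : ∀ s ∈ Icc 0 T, Real.exp (L * |t - s|) ≤ Real.exp (L * T) := fun s hs => by
    gcongr
    rw [abs_le]
    constructor <;> linarith [hs.1, hs.2, ht.1, ht.2]
  have hK := hρ₀.bound_nonneg
  rw [ENNReal.ofReal_add (by positivity) (by positivity), add_smul, massAt]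
  refine add_le_add (hρ₀.map_le (measurable_flow_position hv hW t 0) (by positivity) ?_)
    (hu.map_le (measurable_flow_start hv hW t 0) (by positivity) ?_)
  · intro x _ y _
    refine (abs_sub_le_flow hv hW t 0 x y).trans ?_
    exact mul_le_mul_of_nonneg_right (hexp 0 ⟨le_rfl, ht.1.trans ht.2⟩) (abs_nonneg _)
  · intro x hx y _
    -- compare at time `x` the characteristics through `(x, 0)` and `(y, 0)`
    have h1 := (isCharacteristic_flow hv hW y 0).mul_abs_sub_le hv y x
    have h2 := (isCharacteristic_flow hv hW x 0).abs_sub_le_exp hv hW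
      (isCharacteristic_flow hv hW y 0) t x
    rw [flow_self hv hW] at h1
    rw [flow_self hv hW, abs_sub_comm x t] at h2
    rw [sub_zero] at h1
    rw [zero_sub, abs_neg] at h2
    rw [div_mul_eq_mul_div, le_div_iff₀' hc]
    exact h1.trans (h2.trans (mul_le_mul_of_nonneg_right
      (hexp x (Ioo_subset_Icc_self hx)) (abs_nonneg _)))

end MassAt

/-- A measurable family of measures that are dominated by a multiple of Lebesgue measure has
jointly measurable, uniformly bounded densities on `(0, 1)`. -/
theorem exists_measurable_density {ν : ℝ → Measure ℝ} (hν : Measurable ν) {C : ℝ≥0∞}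
    (hC : C < ∞) (hνC : ∀ t, ν t univ ≤ C) {S : Set ℝ} {K : ℝ} (hK : 0 ≤ K)
    (hνK : ∀ t ∈ S, ν t ≤ ENNReal.ofReal K • volume) :
    ∃ ρ : ℝ → ℝ → ℝ, (Measurable fun z : ℝ × ℝ => ρ z.1 z.2) ∧ (∀ t x, 0 ≤ ρ t x) ∧
      (∀ t x, ρ t x ≤ K) ∧ ∀ t ∈ S, (ν t).restrict (Ioo 0 1) =
        (volume.restrict (Ioo 0 1)).withDensity fun x => ENNReal.ofReal (ρ t x) := by
  let κ₀ : ProbabilityTheory.Kernel ℝ ℝ := ⟨ν, hν⟩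
  have : ProbabilityTheory.IsFiniteKernel κ₀ := ⟨⟨C, hC, hνC⟩⟩
  let κ := κ₀.restrict (measurableSet_Ioo (a := (0 : ℝ)) (b := 1))
  let η : ProbabilityTheory.Kernel ℝ ℝ :=
    ProbabilityTheory.Kernel.const ℝ (volume.restrict (Ioo (0 : ℝ) 1))
  have hκ : ∀ t, κ t = (ν t).restrict (Ioo 0 1) := fun t =>
    ProbabilityTheory.Kernel.restrict_apply _ _ _
  have hη : ∀ t, η t = volume.restrict (Ioo 0 1) := fun t =>
    ProbabilityTheory.Kernel.const_apply _ _
  refine ⟨fun t x => (min (κ.rnDeriv η t x) (ENNReal.ofReal K)).toReal, ?_,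
    fun t x => ENNReal.toReal_nonneg, fun t x => ?_, fun t ht => ?_⟩
  · exact ((ProbabilityTheory.Kernel.measurable_rnDeriv κ η).min measurable_const).ennreal_toReal
  · exact ENNReal.toReal_le_of_le_ofReal hK (min_le_right _ _)
  · have hle : κ t ≤ ENNReal.ofReal K • η t := by
      rw [hκ, hη, ← Measure.restrict_smul]
      exact Measure.restrict_mono le_rfl (hνK t ht)
    have hac : κ t ≪ η t := Measure.absolutelyContinuous_of_le_smul hle
    have hbd : κ.rnDeriv η t ≤ᵐ[η t] fun _ => ENNReal.ofReal K := by
      refine ae_le_of_forall_setLIntegral_le_of_sigmaFinite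
        (ProbabilityTheory.Kernel.measurable_rnDeriv_right κ η t) fun s hs _ => ?_
      rw [ProbabilityTheory.Kernel.setLIntegral_rnDeriv hac hs, lintegral_const,
        Measure.restrict_apply_univ]
      exact hle s
    rw [← hκ, ← ProbabilityTheory.Kernel.withDensity_rnDeriv_eq hac,
      ProbabilityTheory.Kernel.withDensity_apply _
        (ProbabilityTheory.Kernel.measurable_rnDeriv κ η), hη]
    rw [hη] at hbd
    refine withDensity_congr_ae ?_
    filter_upwards [hbd] with x hx
    rw [min_eq_left hx, ENNReal.ofReal_toReal (hx.trans_lt ENNReal.ofReal_lt_top).ne]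

section Density

variable {ν : Measure ℝ} {r : ℝ → ℝ}

lemma setIntegral_mul_eq_of_restrict_eq_withDensity (hr : Measurable r) (hr0 : ∀ x, 0 ≤ r x)
    (h : ν.restrict (Ioo 0 1) =
      (volume.restrict (Ioo 0 1)).withDensity fun x => ENNReal.ofReal (r x)) (g : ℝ → ℝ) :
    ∫ x in Ioo 0 1, r x * g x = ∫ x in Ioo 0 1, g x ∂ν := by
  rw [h, integral_withDensity_eq_integral_toReal_smul hr.ennreal_ofReal
    (Eventually.of_forall fun x => ENNReal.ofReal_lt_top)]
  congr 1 with x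
  rw [ENNReal.toReal_ofReal (hr0 x), smul_eq_mul]

lemma setIntegral_eq_of_restrict_eq_withDensity (hr : Measurable r) (hr0 : ∀ x, 0 ≤ r x)
    (h : ν.restrict (Ioo 0 1) =
      (volume.restrict (Ioo 0 1)).withDensity fun x => ENNReal.ofReal (r x)) {A : Set ℝ}
    (hA : MeasurableSet A) (hA1 : A ⊆ Ioo 0 1) :
    ∫ x in A, r x = ν.real A := by
  have h1 := setIntegral_mul_eq_of_restrict_eq_withDensity hr hr0 h (A.indicator 1)
  rw [setIntegral_indicator hA, inter_eq_right.2 hA1] at h1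
  simp only [Pi.one_apply, integral_const, smul_eq_mul, mul_one, measureReal_restrict_apply_univ]
    at h1
  rw [← h1]
  have h2 : (fun x => r x * A.indicator 1 x) = A.indicator r := by
    ext x
    by_cases hx : x ∈ A <;> simp [hx]
  rw [h2, setIntegral_indicator hA, inter_eq_right.2 hA1]

end Density

section TotalMass

variable {vel : ℝ → ℝ → ℝ} {L c Λ T K : ℝ} {ρ₀ u W : ℝ → ℝ} {ρ : ℝ → ℝ → ℝ}

/-- Inside `(0, 1)` there is exactly the mass behind the exiting characteristic. -/
lemma massAt_real_Ioo (hv : IsVelocity vel L c Λ) (hW : Continuous W) (hρ₀ : IsDatum 0 1 K ρ₀)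
    (hu : IsDatum 0 T K u) {t : ℝ} (ht : t ∈ Icc 0 T) :
    (massAt vel ρ₀ u W t).real (Ioo 0 1) = massFunctional vel ρ₀ u W t := by
  have := hρ₀.isFiniteMeasure
  have := hu.isFiniteMeasure
  have hm1 : MeasurableSet {x | flow vel W t 0 x ∈ Ioo (0 : ℝ) 1} :=
    measurable_flow_position hv hW t 0 measurableSet_Ioo
  have hm2 : MeasurableSet {s | flow vel W t s 0 ∈ Ioo (0 : ℝ) 1} :=
    measurable_flow_start hv hW t 0 measurableSet_Ioo
  rw [measureReal_def, massAt_apply hv hW t measurableSet_Ioo,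
    ENNReal.toReal_add (measure_ne_top _ _) (measure_ne_top _ _), ← measureReal_def,
    ← measureReal_def, hρ₀.measureReal_apply hm1, hu.measureReal_apply hm2, massFunctional,
    massBehind]
  -- a mass element is to the left of `1` at time `t` iff it is behind the exiting characteristic
  have hlt : ∀ s x, flow vel W t s x < 1 ↔ x < flow vel W s t 1 := fun s x => by
    rw [← (flow_strictMono hv hW s t).lt_iff_lt, flow_flow hv hW, flow_self hv hW]
  congr 1
  · rw [← integral_indicator hm1, ← integral_indicator measurableSet_Iio]
    congr 1 with x
    by_cases hx : x ∈ Ioo (0 : ℝ) 1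
    · have h0 : 0 < flow vel W t 0 x := by
        have := ((isCharacteristic_flow hv hW 0 x).strictMono hv).monotone ht.1
        simp only [flow_self hv hW] at this
        exact hx.1.trans_le this
      simp only [indicator, mem_ofPred_eq, mem_Ioo, h0, true_and, mem_Iio, hlt]
    · simp [indicator, hρ₀.eq_zero x hx]
  · rw [← integral_indicator hm2, ← integral_indicator
      ((isCharacteristic_flow hv hW t 1).measurableSet_pos t)]
    congr 1 with s
    by_cases hs : s ∈ Ioo (0 : ℝ) T
    · have h0 : 0 < flow vel W t s 0 ↔ s < t := by
        have := ((isCharacteristic_flow hv hW s 0).strictMono hv).lt_iff_lt (a := s) (b := t)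
        simpa only [flow_self hv hW] using this
      simp only [indicator, mem_ofPred_eq, mem_Ioo, h0, hlt, mem_inter_iff, hs.1, true_and]
    · simp [indicator, hu.eq_zero s hs]

end TotalMass

/-! ### Continuity in time of the densities -/

/-- Continuity of translations in `L¹`, for maps near the identity: if `μ` has a density, then
`μ (g⁻¹ A)` does not exceed `μ A` by much, uniformly in `A`, when `g` moves points and expands
preimages only a little. The density is approximated by a continuous function with compact
support. -/
theorem exists_measureReal_preimage_le {μ : Measure ℝ} {h : ℝ → ℝ} (hint : Integrable h)
    (h0 : ∀ x, 0 ≤ h x) (hμ : ∀ A, MeasurableSet A → μ.real A = ∫ x in A, h x) {ε : ℝ}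
    (hε : 0 < ε) :
    ∃ δ > 0, ∀ g : ℝ → ℝ, Measurable g → (∀ x, |g x - x| ≤ δ) →
      volume.map g ≤ ENNReal.ofReal (1 + δ) • volume →
      ∀ A, MeasurableSet A → μ.real (g ⁻¹' A) ≤ μ.real A + ε := by
  obtain ⟨k, hkc, hkε, hk, hki⟩ := hint.exists_hasCompactSupport_integral_sub_le
    (show 0 < ε / 4 by positivity)
  obtain ⟨R, hR⟩ := hkc.isCompact.isBounded.subset_closedBall 0
  have hR' : ∀ x, x ∉ Icc (-R) R → k x = 0 := fun x hx => by
    by_contra hne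
    refine hx ?_
    have := hR (subset_tsupport _ hne)
    rwa [Real.closedBall_eq_Icc, zero_sub, zero_add] at this
  have huc := hkc.uniformContinuous_of_continuous hk
  set η : ℝ := ε / (4 * (2 * |R| + 1))
  have hη : 0 < η := by positivity
  obtain ⟨d, hd, hdk⟩ := Metric.uniformContinuous_iff.1 huc η hη
  set N : ℝ := ∫ x, |k x|
  have hN : 0 ≤ N := integral_nonneg fun x => abs_nonneg _
  refine ⟨min (d / 2) (ε / (4 * (N + 1))), by positivity, fun g hg hgδ hgv A hA => ?_⟩
  set δ := min (d / 2) (ε / (4 * (N + 1)))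
  have hδ0 : 0 < δ := by positivity
  have hkabs : Integrable (fun x => |k x|) := hki.abs
  have hsub : Integrable (fun x => ‖h x - k x‖) := (hint.sub hki).norm
  -- `h` is replaced by `k`
  have e1 : ∫ x in g ⁻¹' A, h x ≤ (∫ x in g ⁻¹' A, |k x|) + ε / 4 := by
    have : ∫ x in g ⁻¹' A, h x ≤ ∫ x in g ⁻¹' A, (|k x| + ‖h x - k x‖) := by
      refine integral_mono hint.integrableOn
        (hkabs.integrableOn.add hsub.integrableOn) fun x => ?_
      have h1 := le_abs_self (h x - k x)
      have h2 := le_abs_self (k x)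
      simp only [Real.norm_eq_abs]
      linarith
    rw [integral_add hkabs.integrableOn hsub.integrableOn] at this
    have h2 := setIntegral_le_integral (s := g ⁻¹' A) hsub
      (Eventually.of_forall fun x => norm_nonneg _)
    linarith
  have hmapint : Integrable (fun y => |k y|) (volume.map g) :=
    (hkabs.smul_measure ENNReal.ofReal_ne_top).mono_measure hgv
  have hkg : Integrable (fun x => |k (g x)|) := hmapint.comp_measurable hg
  -- `k` is replaced by `k ∘ g`
  have e2 : ∫ x in g ⁻¹' A, |k x| ≤ (∫ x in g ⁻¹' A, |k (g x)|) + ε / 4 := by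
    have hind : Integrable ((Icc (-R) R).indicator fun _ : ℝ => η) := by
      rw [integrable_indicator_iff measurableSet_Icc]
      exact integrableOn_const (by simp)
    have : ∫ x in g ⁻¹' A, |k x| ≤
        ∫ x in g ⁻¹' A, (|k (g x)| + (Icc (-R) R).indicator (fun _ => η) x) := by
      refine integral_mono hkabs.integrableOn (hkg.integrableOn.add hind.integrableOn)
        fun x => ?_
      by_cases hx : x ∈ Icc (-R) R
      · have h1 : dist (k x) (k (g x)) < η := hdk (by
          rw [dist_comm, Real.dist_eq]
          have : δ ≤ d / 2 := min_le_left _ _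
          linarith [hgδ x])
        rw [Real.dist_eq] at h1
        have h2 := abs_sub_abs_le_abs_sub (k x) (k (g x))
        simp only [indicator_of_mem hx]
        linarith
      · simp only [indicator_of_notMem hx, hR' x hx, abs_zero, add_zero]
        exact abs_nonneg _
    rw [integral_add hkg.integrableOn hind.integrableOn] at this
    have h2 := setIntegral_le_integral (s := g ⁻¹' A) hind
      (Eventually.of_forall fun x => indicator_nonneg (fun _ _ => hη.le) x)
    rw [integral_indicator (μ := volume) measurableSet_Icc, setIntegral_const, smul_eq_mul] at h2
    have h3 : volume.real (Icc (-R) R) * η ≤ ε / 4 := by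
      have h4 : volume.real (Icc (-R) R) ≤ 2 * |R| + 1 := by
        rw [measureReal_def, Real.volume_Icc]
        refine ENNReal.toReal_le_of_le_ofReal (by positivity) (ENNReal.ofReal_le_ofReal ?_)
        linarith [le_abs_self R]
      refine (mul_le_mul_of_nonneg_right h4 hη.le).trans_eq ?_
      simp only [η]
      field_simp
    linarith
  -- change of variables
  have e3 : ∫ x in g ⁻¹' A, |k (g x)| ≤ (∫ y in A, |k y|) + ε / 4 := by
    rw [← setIntegral_map (f := fun y => |k y|) hA hmapint.aestronglyMeasurable hg.aemeasurable]
    have h1 : ∫ y in A, |k y| ∂(volume.map g) ≤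
        ∫ y in A, |k y| ∂(ENNReal.ofReal (1 + δ) • volume) :=
      integral_mono_measure (Measure.restrict_mono le_rfl hgv)
        (Eventually.of_forall fun x => abs_nonneg _)
        (hkabs.smul_measure ENNReal.ofReal_ne_top).integrableOn
    rw [Measure.restrict_smul, integral_smul_measure, ENNReal.toReal_ofReal (by positivity),
      smul_eq_mul] at h1
    have h2 : ∫ y in A, |k y| ≤ N := setIntegral_le_integral hkabs
      (Eventually.of_forall fun x => abs_nonneg _)
    have h3 : δ * ∫ y in A, |k y| ≤ ε / 4 := by
      have h4 : δ * ∫ y in A, |k y| ≤ ε / (4 * (N + 1)) * N :=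
        mul_le_mul (min_le_right _ _) h2 (integral_nonneg fun x => abs_nonneg _) (by positivity)
      refine h4.trans ?_
      rw [div_mul_eq_mul_div, div_le_div_iff₀ (by positivity) (by positivity)]
      nlinarith
    linarith
  -- `k` is replaced by `h` again
  have e4 : ∫ y in A, |k y| ≤ (∫ y in A, h y) + ε / 4 := by
    have : ∫ x in A, |k x| ≤ ∫ x in A, (h x + ‖h x - k x‖) := by
      refine integral_mono hkabs.integrableOn
        (hint.integrableOn.add hsub.integrableOn) fun x => ?_
      have h1 := abs_sub_abs_le_abs_sub (k x) (h x)
      rw [abs_sub_comm, abs_of_nonneg (h0 x)] at h1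
      simp only [Real.norm_eq_abs]
      linarith
    rw [integral_add hint.integrableOn hsub.integrableOn] at this
    have h2 := setIntegral_le_integral (s := A) hsub
      (Eventually.of_forall fun x => norm_nonneg _)
    linarith
  rw [hμ _ (hg hA), hμ _ hA]
  linarith

section Continuity

variable {vel : ℝ → ℝ → ℝ} {L c Λ T K : ℝ} {ρ₀ u W : ℝ → ℝ}

lemma map_flow_volume_le (hv : IsVelocity vel L c Λ) (hW : Continuous W) (s t : ℝ) :
    volume.map (fun x => flow vel W t s x) ≤ ENNReal.ofReal (Real.exp (L * |t - s|)) • volume := by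
  refine Measure.le_iff.2 fun A hA => ?_
  rw [Measure.map_apply (measurable_flow_position hv hW t s) hA]
  have := volume_inter_preimage_le (S := univ) (Real.exp_pos (L * |t - s|)).le
    (fun x _ y _ => abs_sub_le_flow hv hW t s x y) A
  rwa [univ_inter] at this

/-- Setwise continuity of the transported measures, uniformly over all measurable sets. -/
theorem eventually_abs_massAt_sub_le (hv : IsVelocity vel L c Λ) (hW : Continuous W)
    (hρ₀ : IsDatum 0 1 K ρ₀) (hu : IsDatum 0 T K u) {t : ℝ} (ht : t ∈ Icc 0 T) {ε : ℝ}
    (hε : 0 < ε) :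
    ∀ᶠ s in 𝓝 t, ∀ A, MeasurableSet A →
      |(massAt vel ρ₀ u W s).real A - (massAt vel ρ₀ u W t).real A| ≤ ε := by
  have := fun t => isFiniteMeasure_massAt hv hW hρ₀ hu t
  set ν := massAt vel ρ₀ u W
  have hac : ν t ≪ volume :=
    Measure.absolutelyContinuous_of_le_smul (massAt_le hv hW hρ₀ hu ht)
  obtain ⟨δ, hδ, h⟩ := exists_measureReal_preimage_le (μ := ν t)
    (h := fun x => ((ν t).rnDeriv volume x).toReal) Measure.integrable_toReal_rnDeriv
    (fun x => ENNReal.toReal_nonneg)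
    (fun A _ => (Measure.setIntegral_toReal_rnDeriv hac A).symm) hε
  have h1 : ∀ᶠ s in 𝓝 t, Λ * |s - t| < δ :=
    Tendsto.eventually_lt_const hδ (Continuous.tendsto' (by fun_prop) _ _ (by simp))
  have h2 : ∀ᶠ s in 𝓝 t, Real.exp (L * |s - t|) < 1 + δ :=
    Tendsto.eventually_lt_const (v := 1) (by linarith)
      (Continuous.tendsto' (by fun_prop) _ _ (by simp))
  filter_upwards [h1, h2] with s hs1 hs2
  have hle : ∀ A, MeasurableSet A → (ν s).real A ≤ (ν t).real A + ε := by
    intro A hA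
    have hm := measurable_flow_position hv hW s t
    have := h (fun x => flow vel W s t x) hm (fun x => ?_)
      ((map_flow_volume_le hv hW t s).trans ?_) A hA
    · rwa [← map_measureReal_apply hm hA, map_flow_massAt hv hW] at this
    · have := (isCharacteristic_flow hv hW t x).abs_sub_le_mul hv t s
      rw [flow_self hv hW] at this
      exact this.trans hs1.le
    · refine Measure.le_iff.2 fun A _ => ?_
      simp only [Measure.smul_apply, smul_eq_mul]
      exact mul_le_mul_left (ENNReal.ofReal_le_ofReal hs2.le) _
  intro A hA
  rw [abs_sub_le_iff]
  have e1 := hle A hA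
  have e2 := hle Aᶜ hA.compl
  have huniv : (ν s).real univ = (ν t).real univ := by
    rw [measureReal_def, measureReal_def, massAt_univ hv hW, massAt_univ hv hW]
  rw [measureReal_compl hA, measureReal_compl hA, huniv] at e2
  constructor <;> linarith

end Continuity

/-- Curves of uniformly bounded densities are `L^p` continuous, for `p` finite, if the measures
depend continuously on time in total variation. -/
theorem continuousInLp_of_eventually_abs_measureReal_sub_le {ν : ℝ → Measure ℝ}
    {ρ : ℝ → ℝ → ℝ} {K T : ℝ} (hρ : ∀ t, Measurable (ρ t)) (hρ0 : ∀ t x, 0 ≤ ρ t x)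
    (hρK : ∀ t x, ρ t x ≤ K)
    (hν : ∀ t ∈ Icc 0 T, (ν t).restrict (Ioo 0 1) =
        (volume.restrict (Ioo 0 1)).withDensity fun x => ENNReal.ofReal (ρ t x))
    (hcont : ∀ t ∈ Icc 0 T, ∀ ε > 0, ∀ᶠ s in 𝓝 t, ∀ A, MeasurableSet A →
      |(ν s).real A - (ν t).real A| ≤ ε)
    {p : ℝ≥0∞} (hp1 : 1 ≤ p) (hp : p ≠ ∞) : ContinuousInLp T p ρ := by
  have hK : 0 ≤ K := (hρ0 0 0).trans (hρK 0 0)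
  have hmem : ∀ t, ∀ q, MemLp (ρ t) q (volume.restrict (Ioo 0 1)) := fun t q =>
    MemLp.of_bound (hρ t).aestronglyMeasurable K (Eventually.of_forall fun x => by
      rw [Real.norm_eq_abs, abs_of_nonneg (hρ0 t x)]; exact hρK t x)
  have hi : ∀ t, Integrable (ρ t) (volume.restrict (Ioo 0 1)) := fun t =>
    memLp_one_iff_integrable.1 (hmem t 1)
  refine ⟨fun t _ => hmem t p, fun t ht => ?_⟩
  -- continuity in `L¹`
  have hL1 : Tendsto (fun s => ∫⁻ x in Ioo 0 1, ‖ρ s x - ρ t x‖ₑ) (𝓝[Icc 0 T] t) (𝓝 0) := by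
    have hreal : Tendsto (fun s => ∫ x in Ioo 0 1, ‖ρ s x - ρ t x‖) (𝓝[Icc 0 T] t) (𝓝 0) := by
      refine Metric.tendsto_nhds.2 fun ε hε => ?_
      filter_upwards [self_mem_nhdsWithin, mem_nhdsWithin_of_mem_nhds
        (hcont t ht (ε / 4) (by positivity))] with s hs hsA
      rw [Real.dist_eq, sub_zero, abs_of_nonneg (integral_nonneg fun x => norm_nonneg _)]
      have hA : MeasurableSet {x | ρ t x ≤ ρ s x} := measurableSet_le (hρ t) (hρ s)
      have hbound : ∀ B, MeasurableSet B → B ⊆ Ioo 0 1 →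
          |∫ x in B, (ρ s x - ρ t x)| ≤ ε / 4 := fun B hB hB1 => by
        have hr : volume.restrict B ≤ volume.restrict (Ioo 0 1) := Measure.restrict_mono hB1 le_rfl
        rw [integral_sub ((hi s).mono_measure hr) ((hi t).mono_measure hr),
          setIntegral_eq_of_restrict_eq_withDensity (hρ s) (hρ0 s) (hν s hs) hB hB1,
          setIntegral_eq_of_restrict_eq_withDensity (hρ t) (hρ0 t) (hν t ht) hB hB1]
        exact hsA B hB
      have hnorm : Integrable (fun x => ‖ρ s x - ρ t x‖) (volume.restrict (Ioo 0 1)) :=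
        ((hi s).sub (hi t)).norm
      rw [← integral_inter_add_sdiff hA hnorm]
      have e1 : ∫ x in Ioo 0 1 ∩ {x | ρ t x ≤ ρ s x}, ‖ρ s x - ρ t x‖ =
          ∫ x in Ioo 0 1 ∩ {x | ρ t x ≤ ρ s x}, (ρ s x - ρ t x) :=
        setIntegral_congr_fun (measurableSet_Ioo.inter hA) fun x hx => by
          rw [Real.norm_eq_abs, abs_of_nonneg (sub_nonneg.2 hx.2)]
      have e2 : ∫ x in Ioo 0 1 \ {x | ρ t x ≤ ρ s x}, ‖ρ s x - ρ t x‖ =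
          -∫ x in Ioo 0 1 \ {x | ρ t x ≤ ρ s x}, (ρ s x - ρ t x) := by
        rw [← integral_neg]
        refine setIntegral_congr_fun (measurableSet_Ioo.diff hA) fun x hx => ?_
        rw [Real.norm_eq_abs, abs_of_neg (sub_neg.2 (not_le.1 hx.2))]
      rw [e1, e2]
      have b1 := hbound _ (measurableSet_Ioo.inter hA) inter_subset_left
      have b2 := hbound _ (measurableSet_Ioo.diff hA) sdiff_subset
      linarith [(abs_le.1 b1).2, (abs_le.1 b2).1]
    have := ENNReal.tendsto_ofReal hreal
    rw [ENNReal.ofReal_zero] at this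
    refine this.congr fun s => ?_
    exact ofReal_integral_norm_eq_lintegral_enorm ((hi s).sub (hi t))
  -- interpolation with the uniform bound
  have hp0 : p ≠ 0 := (zero_lt_one.trans_le hp1).ne'
  have hq1 : 1 ≤ p.toReal := by
    rw [← ENNReal.toReal_one]
    exact ENNReal.toReal_mono hp hp1
  have hbd : ∀ s x, ‖ρ s x - ρ t x‖ₑ ≤ ENNReal.ofReal K := fun s x => by
    rw [← ofReal_norm, Real.norm_eq_abs]
    refine ENNReal.ofReal_le_ofReal (abs_le.2 ?_)
    constructor <;> linarith [hρ0 s x, hρ0 t x, hρK s x, hρK t x]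
  have hle : ∀ s, eLpNorm (fun x => ρ s x - ρ t x) p (volume.restrict (Ioo 0 1)) ≤
      (ENNReal.ofReal K ^ (p.toReal - 1) * ∫⁻ x in Ioo 0 1, ‖ρ s x - ρ t x‖ₑ) ^
        (1 / p.toReal) := fun s => by
    rw [eLpNorm_eq_lintegral_rpow_enorm_toReal hp0 hp, ← lintegral_const_mul' _ _
      (ENNReal.rpow_ne_top_of_nonneg (by linarith) ENNReal.ofReal_ne_top)]
    refine ENNReal.rpow_le_rpow (lintegral_mono fun x => ?_) (by positivity)
    calc ‖ρ s x - ρ t x‖ₑ ^ p.toReal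
        = ‖ρ s x - ρ t x‖ₑ ^ (p.toReal - 1) * ‖ρ s x - ρ t x‖ₑ := by
          nth_rewrite 3 [← ENNReal.rpow_one ‖ρ s x - ρ t x‖ₑ]
          rw [← ENNReal.rpow_add_of_nonneg _ _ (by linarith) zero_le_one, sub_add_cancel]
      _ ≤ _ := by
          gcongr
          exact hbd s x
  have hlim : Tendsto (fun s => (ENNReal.ofReal K ^ (p.toReal - 1) *
      ∫⁻ x in Ioo 0 1, ‖ρ s x - ρ t x‖ₑ) ^ (1 / p.toReal)) (𝓝[Icc 0 T] t) (𝓝 0) := by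
    have h1 := ENNReal.Tendsto.const_mul (a := ENNReal.ofReal K ^ (p.toReal - 1)) hL1
      (Or.inr (ENNReal.rpow_ne_top_of_nonneg (by linarith) ENNReal.ofReal_ne_top))
    have h2 := h1.ennrpow_const (1 / p.toReal)
    rwa [mul_zero, ENNReal.zero_rpow_of_pos (by positivity)] at h2
  exact tendsto_of_tendsto_of_tendsto_of_le_of_le tendsto_const_nhds hlim
    (fun _ => zero_le) hle

/-! ### The weak formulation for the transported density -/

/-- The derivative of a test function in the direction `(1, vel(x, W(t)))` of the
characteristics, set to zero outside the open rectangle `(0, τ) × (0, 1)`. -/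
def materialDeriv (vel : ℝ → ℝ → ℝ) (W : ℝ → ℝ) (τ : ℝ) (φ : ℝ → ℝ → ℝ) : ℝ × ℝ → ℝ :=
  (Ioo 0 τ ×ˢ Ioo 0 1).indicator fun z =>
    fderivWithin ℝ (fun z : ℝ × ℝ => φ z.1 z.2) (Icc 0 τ ×ˢ Icc 0 1) z (1, vel z.2 (W z.1))

section MaterialDeriv

variable {vel : ℝ → ℝ → ℝ} {L c Λ τ : ℝ} {W X : ℝ → ℝ} {φ : ℝ → ℝ → ℝ}

lemma IsTestFunction.continuousOn_fderivWithin_apply (hφ : IsTestFunction τ φ) (hτ : 0 < τ)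
    (hv : IsVelocity vel L c Λ) (hW : Continuous W) :
    ContinuousOn (fun z : ℝ × ℝ => fderivWithin ℝ (fun z : ℝ × ℝ => φ z.1 z.2)
      (Icc 0 τ ×ˢ Icc 0 1) z (1, vel z.2 (W z.1))) (Icc 0 τ ×ˢ Icc 0 1) := by
  refine (hφ.contDiffOn.continuousOn_fderivWithin
    ((uniqueDiffOn_Icc hτ).prod (uniqueDiffOn_Icc zero_lt_one)) le_rfl).clm_apply ?_
  have hvc := hv.continuous_uncurry
  exact (continuous_const.prodMk (hvc.comp
    (continuous_snd.prodMk (hW.comp continuous_fst)))).continuousOn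

lemma IsTestFunction.measurable_materialDeriv (hφ : IsTestFunction τ φ) (hτ : 0 < τ)
    (hv : IsVelocity vel L c Λ) (hW : Continuous W) :
    Measurable (materialDeriv vel W τ φ) := by
  have h := (hφ.continuousOn_fderivWithin_apply hτ hv hW).mono
    (prod_mono (Ioo_subset_Icc_self (a := 0) (b := τ)) (Ioo_subset_Icc_self (a := 0) (b := 1)))
  classical
  rw [materialDeriv, ← piecewise_eq_indicator]
  exact h.measurable_piecewise continuousOn_const (measurableSet_Ioo.prod measurableSet_Ioo)

lemma IsTestFunction.exists_abs_materialDeriv_le (hφ : IsTestFunction τ φ) (hτ : 0 < τ)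
    (hv : IsVelocity vel L c Λ) (hW : Continuous W) :
    ∃ M, ∀ z, |materialDeriv vel W τ φ z| ≤ M := by
  obtain ⟨M, hM⟩ := (isCompact_Icc.prod isCompact_Icc).exists_bound_of_continuousOn
    (hφ.continuousOn_fderivWithin_apply hτ hv hW)
  refine ⟨M, fun z => ?_⟩
  by_cases hz : z ∈ Ioo 0 τ ×ˢ Ioo (0 : ℝ) 1
  · rw [materialDeriv, indicator_of_mem hz]
    exact hM z ⟨Ioo_subset_Icc_self hz.1, Ioo_subset_Icc_self hz.2⟩
  · rw [materialDeriv, indicator_of_notMem hz, abs_zero]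
    exact (norm_nonneg _).trans (hM (0, 0) ⟨by simp [hτ.le], by simp⟩)

lemma IsTestFunction.materialDeriv_eq (hφ : IsTestFunction τ φ) {t x : ℝ} (ht : t ∈ Ioo 0 τ)
    (hx : x ∈ Ioo (0 : ℝ) 1) :
    materialDeriv vel W τ φ (t, x) = derivWithin (fun s => φ s x) (Icc 0 τ) t +
      vel x (W t) * derivWithin (fun y => φ t y) (Icc 0 1) x := by
  have hτ : 0 < τ := ht.1.trans ht.2
  have ht' := Ioo_subset_Icc_self ht
  have hx' := Ioo_subset_Icc_self hx
  have hd := (hφ.contDiffOn.differentiableOn one_ne_zero (t, x) ⟨ht', hx'⟩).hasFDerivWithinAt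
  set D := fderivWithin ℝ (fun z : ℝ × ℝ => φ z.1 z.2) (Icc 0 τ ×ˢ Icc 0 1) (t, x)
  have h1 : HasDerivWithinAt (fun s => φ s x) (D (1, 0)) (Icc 0 τ) t :=
    hd.comp_hasDerivWithinAt (f := fun s => (s, x)) t
      ((hasDerivWithinAt_id t _).prodMk (hasDerivWithinAt_const t _ x)) fun s hs => ⟨hs, hx'⟩
  have h2 : HasDerivWithinAt (fun y => φ t y) (D (0, 1)) (Icc 0 1) x :=
    hd.comp_hasDerivWithinAt (f := fun y => (t, y)) x
      ((hasDerivWithinAt_const x _ t).prodMk (hasDerivWithinAt_id x _)) fun y hy => ⟨ht', hy⟩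
  rw [h1.derivWithin (uniqueDiffOn_Icc hτ t ht'),
    h2.derivWithin (uniqueDiffOn_Icc zero_lt_one x hx'), materialDeriv,
    indicator_of_mem (show (t, x) ∈ Ioo 0 τ ×ˢ Ioo (0 : ℝ) 1 from ⟨ht, hx⟩)]
  change D (1, vel x (W t)) = _
  rw [← smul_eq_mul, ← map_smul, ← map_add]
  simp

/-- Along a characteristic that starts at time `a` in the rectangle, either at `t = 0` or at
`x = 0`, the material derivative of a test function integrates to minus its initial value,
because the test function vanishes where the characteristic leaves the rectangle. -/
theorem IsTestFunction.integral_materialDeriv (hφ : IsTestFunction τ φ)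
    (hv : IsVelocity vel L c Λ) (hW : Continuous W) (hX : IsCharacteristic vel W X) {a : ℝ}
    (ha : a ∈ Ico 0 τ) (hXa : X a ∈ Ico (0 : ℝ) 1) (hstart : a = 0 ∨ X a = 0) :
    ∫ t in Ioo 0 τ, materialDeriv vel W τ φ (t, X t) = -φ a (X a) := by
  have hτ : 0 < τ := ha.1.trans_lt ha.2
  have hmono := hX.strictMono hv
  -- the exit time
  obtain ⟨b, hab, hbτ, hXb, hout, hφb⟩ : ∃ b, a < b ∧ b ≤ τ ∧ X b ≤ 1 ∧
      (∀ t ∈ Ioo 0 τ, b ≤ t → 1 ≤ X t) ∧ φ b (X b) = 0 := by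
    rcases le_or_gt (X τ) 1 with h | h
    · refine ⟨τ, ha.2, le_rfl, h, fun t ht hbt => absurd hbt (not_le.2 ht.2), ?_⟩
      exact hφ.final_eq_zero _ ⟨hXa.1.trans (hmono.monotone ha.2.le), h⟩
    · obtain ⟨b, hb, hb1⟩ := intermediate_value_Ioo ha.2.le hX.continuous.continuousOn
        ⟨hXa.2, h⟩
      refine ⟨b, hb.1, hb.2.le, hb1.le, fun t _ hbt => hb1 ▸ hmono.monotone hbt, ?_⟩
      rw [hb1]
      exact hφ.right_eq_zero b ⟨ha.1.trans hb.1.le, hb.2.le⟩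
  have hmem : ∀ t ∈ Icc a b, (t, X t) ∈ Icc 0 τ ×ˢ Icc (0 : ℝ) 1 := fun t ht =>
    ⟨⟨ha.1.trans ht.1, ht.2.trans hbτ⟩, hXa.1.trans (hmono.monotone ht.1),
      (hmono.monotone ht.2).trans hXb⟩
  have hmem' : ∀ t ∈ Ioo a b, (t, X t) ∈ Ioo 0 τ ×ˢ Ioo (0 : ℝ) 1 := fun t ht =>
    ⟨⟨ha.1.trans_lt ht.1, ht.2.trans_le hbτ⟩, hXa.1.trans_lt (hmono ht.1),
      (hmono ht.2).trans_le hXb⟩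
  have hzero : ∀ t ∈ Ioo 0 τ, t ∉ Ioo a b → materialDeriv vel W τ φ (t, X t) = 0 := by
    intro t ht htn
    rw [materialDeriv, indicator_of_notMem]
    rintro ⟨-, hx⟩
    rcases le_or_gt t a with hta | hta
    · rcases hstart with h0 | h0
      · exact absurd (h0 ▸ hta) (not_le.2 ht.1)
      · exact absurd hx.1 (not_lt.2 (h0 ▸ hmono.monotone hta))
    · have hbt : b ≤ t := not_lt.1 fun h => htn ⟨hta, h⟩
      exact absurd hx.2 (not_lt.2 (hout t ht hbt))
  rw [setIntegral_eq_of_subset_of_forall_sdiff_eq_zero measurableSet_Ioo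
    (Ioo_subset_Ioo ha.1 hbτ) (fun t ht => hzero t ht.1 ht.2)]
  have hpath : Continuous fun t => (t, X t) := continuous_id.prodMk hX.continuous
  have hFTC := intervalIntegral.integral_eq_sub_of_hasDerivAt_of_le hab.le
    (f := fun t => φ t (X t)) (f' := fun t => fderivWithin ℝ (fun z : ℝ × ℝ => φ z.1 z.2)
      (Icc 0 τ ×ˢ Icc 0 1) (t, X t) (1, vel (X t) (W t)))
    (hφ.contDiffOn.continuousOn.comp hpath.continuousOn hmem) (fun t ht => ?_)
    (ContinuousOn.intervalIntegrable ?_)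
  · rw [hφb, zero_sub, intervalIntegral.integral_of_le hab.le, integral_Ioc_eq_integral_Ioo]
      at hFTC
    rw [← hFTC]
    refine setIntegral_congr_fun measurableSet_Ioo fun t ht => ?_
    simp only [materialDeriv, indicator_of_mem (hmem' t ht)]
  · have hnhds : Icc 0 τ ×ˢ Icc (0 : ℝ) 1 ∈ 𝓝 (t, X t) :=
      mem_of_superset ((isOpen_Ioo.prod isOpen_Ioo).mem_nhds (hmem' t ht))
        (prod_mono Ioo_subset_Icc_self Ioo_subset_Icc_self)
    have hd := (hφ.contDiffOn.differentiableOn one_ne_zero (t, X t)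
      (mem_of_mem_nhds hnhds)).hasFDerivWithinAt.hasFDerivAt hnhds
    exact hd.comp_hasDerivAt (f := fun s => (s, X s)) t ((hasDerivAt_id t).prodMk (hX t))
  · rw [uIcc_of_le hab.le]
    exact (hφ.continuousOn_fderivWithin_apply hτ hv hW).comp hpath.continuousOn hmem

end MaterialDeriv

section WeakEq

variable {vel : ℝ → ℝ → ℝ} {L c Λ T K : ℝ} {ρ₀ u W : ℝ → ℝ}

lemma IsDatum.integral_integral_swap {a b : ℝ} {f : ℝ → ℝ} (hf : IsDatum a b K f) {τ M : ℝ}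
    {G : ℝ → ℝ → ℝ} (hG : Measurable fun z : ℝ × ℝ => G z.1 z.2) (hGM : ∀ t y, |G t y| ≤ M) :
    ∫ t in Ioo 0 τ, ∫ y, f y * G t y = ∫ y, f y * ∫ t in Ioo 0 τ, G t y := by
  simp_rw [← integral_const_mul]
  refine MeasureTheory.integral_integral_swap ?_
  have h1 : Integrable (fun z : ℝ × ℝ => f z.2) ((volume.restrict (Ioo 0 τ)).prod volume) := by
    simpa using (integrable_const (μ := volume.restrict (Ioo 0 τ)) (1 : ℝ)).mul_prod hf.integrable
  exact h1.mul_bdd (c := M) hG.aestronglyMeasurable (Eventually.of_forall fun z => hGM z.1 z.2)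

/-- The transported mass solves the weak formulation: integrate the material derivative of the
test function along each characteristic. -/
theorem integral_integral_materialDeriv_massAt (hv : IsVelocity vel L c Λ) (hW : Continuous W)
    (hρ₀ : IsDatum 0 1 K ρ₀) (hu : IsDatum 0 T K u) {τ : ℝ} (hτ : 0 < τ) {φ : ℝ → ℝ → ℝ}
    (hφ : IsTestFunction τ φ) :
    ∫ t in Ioo 0 τ, ∫ x, materialDeriv vel W τ φ (t, x) ∂(massAt vel ρ₀ u W t) =
      -(∫ t in Ioo 0 τ, u t * φ t 0) - ∫ x in Ioo 0 1, ρ₀ x * φ 0 x := by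
  have := hρ₀.isFiniteMeasure
  have := hu.isFiniteMeasure
  have hGm := hφ.measurable_materialDeriv hτ hv hW
  obtain ⟨M, hM⟩ := hφ.exists_abs_materialDeriv_le hτ hv hW
  set G := materialDeriv vel W τ φ
  have hc := (continuous_flow hv hW).measurable
  have hm1 : Measurable fun z : ℝ × ℝ => G (z.1, flow vel W z.1 0 z.2) :=
    hGm.comp (measurable_fst.prodMk (hc.comp
      (measurable_fst.prodMk (measurable_const.prodMk measurable_snd))))
  have hm2 : Measurable fun z : ℝ × ℝ => G (z.1, flow vel W z.1 z.2 0) :=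
    hGm.comp (measurable_fst.prodMk (hc.comp
      (measurable_fst.prodMk (measurable_snd.prodMk measurable_const))))
  have hGt : ∀ t, Measurable fun x => G (t, x) := fun t =>
    hGm.comp (measurable_const.prodMk measurable_id)
  -- at each time, the integral over the transported mass is an integral over the data
  have hslice : ∀ t, ∫ x, G (t, x) ∂(massAt vel ρ₀ u W t) =
      (∫ y, ρ₀ y * G (t, flow vel W t 0 y)) + ∫ s, u s * G (t, flow vel W t s 0) := by
    intro t
    have f1 := measurable_flow_position hv hW t 0
    have f2 := measurable_flow_start hv hW t 0
    have hi : ∀ (μ : Measure ℝ) [IsFiniteMeasure μ], Integrable (fun x => G (t, x)) μ :=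
      fun μ _ => Integrable.of_bound (hGt t).aestronglyMeasurable M
        (Eventually.of_forall fun x => hM _)
    rw [massAt, integral_add_measure (hi _) (hi _),
      integral_map f1.aemeasurable (hGt t).aestronglyMeasurable,
      integral_map f2.aemeasurable (hGt t).aestronglyMeasurable, hρ₀.integral_eq, hu.integral_eq]
  have hint : ∀ {f : ℝ → ℝ} {a b : ℝ} {H : ℝ → ℝ → ℝ}, IsDatum a b K f →
      (Measurable fun z : ℝ × ℝ => H z.1 z.2) → (∀ t y, |H t y| ≤ M) →
      Integrable (fun t => ∫ y, f y * H t y) (volume.restrict (Ioo 0 τ)) := by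
    intro f a b H hf hH hHM
    have h1 : Integrable (fun z : ℝ × ℝ => f z.2) ((volume.restrict (Ioo 0 τ)).prod volume) := by
      simpa using
        (integrable_const (μ := volume.restrict (Ioo 0 τ)) (1 : ℝ)).mul_prod hf.integrable
    exact (h1.mul_bdd (c := M) hH.aestronglyMeasurable
      (Eventually.of_forall fun z => hHM z.1 z.2)).integral_prod_left
  simp_rw [hslice]
  rw [integral_add (hint (H := fun t y => G (t, flow vel W t 0 y)) hρ₀ hm1 fun t y => hM _)
      (hint (H := fun t s => G (t, flow vel W t s 0)) hu hm2 fun t y => hM _),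
    hρ₀.integral_integral_swap (G := fun t y => G (t, flow vel W t 0 y)) hm1 (fun t y => hM _),
    hu.integral_integral_swap (G := fun t s => G (t, flow vel W t s 0)) hm2 (fun t y => hM _)]
  have e1 : ∫ y, ρ₀ y * ∫ t in Ioo 0 τ, G (t, flow vel W t 0 y) =
      -∫ y in Ioo 0 1, ρ₀ y * φ 0 y := by
    rw [← integral_neg, ← integral_indicator measurableSet_Ioo]
    congr 1 with y
    by_cases hy : y ∈ Ioo (0 : ℝ) 1
    · have := hφ.integral_materialDeriv hv hW (isCharacteristic_flow hv hW 0 y) (a := 0)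
        ⟨le_rfl, hτ⟩ (by rw [flow_self hv hW]; exact ⟨hy.1.le, hy.2⟩) (Or.inl rfl)
      rw [flow_self hv hW] at this
      rw [indicator_of_mem hy, this, mul_neg]
    · rw [indicator_of_notMem hy, hρ₀.eq_zero y hy, zero_mul]
  have e2 : ∫ s, u s * ∫ t in Ioo 0 τ, G (t, flow vel W t s 0) =
      -∫ s in Ioo 0 τ, u s * φ s 0 := by
    rw [← integral_neg, ← integral_indicator measurableSet_Ioo]
    congr 1 with s
    by_cases hs : s ∈ Ioo (0 : ℝ) τ
    · have := hφ.integral_materialDeriv hv hW (isCharacteristic_flow hv hW s 0) (a := s)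
        ⟨hs.1.le, hs.2⟩ (by rw [flow_self hv hW]; exact ⟨le_rfl, zero_lt_one⟩)
        (Or.inr (flow_self hv hW s 0))
      rw [flow_self hv hW] at this
      rw [indicator_of_mem hs, this, mul_neg]
    · rw [indicator_of_notMem hs]
      by_cases hsT : s ∈ Ioo (0 : ℝ) T
      · -- what enters after time `τ` is not in `[0, 1]` before time `τ`
        have hτs : τ ≤ s := not_lt.1 fun h => hs ⟨hsT.1, h⟩
        have : ∫ t in Ioo 0 τ, G (t, flow vel W t s 0) = ∫ t in Ioo 0 τ, (0 : ℝ) := by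
          refine setIntegral_congr_fun measurableSet_Ioo fun t ht => ?_
          refine indicator_of_notMem (fun hmem => ?_) _
          have hlt := ((isCharacteristic_flow hv hW s 0).strictMono hv) (ht.2.trans_le hτs)
          simp only [flow_self hv hW] at hlt
          exact absurd hmem.2.1 (not_lt.2 hlt.le)
        rw [this, integral_zero, mul_zero]
      · rw [hu.eq_zero s hsT, zero_mul]
  rw [e1, e2]
  ring

end WeakEq

/-- Existence for normalised data, with the properties of the solution. -/
theorem exists_isWeakSolution {lam : ℝ → ℝ → ℝ} {T K : ℝ} {ρ₀ u : ℝ → ℝ}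
    (hlam_C1 : ContDiffOn ℝ 1 (fun z : ℝ × ℝ => lam z.1 z.2) (Icc 0 1 ×ˢ Ici 0))
    (hlam_pos : ∀ x ∈ Icc (0 : ℝ) 1, ∀ W ∈ Ici (0 : ℝ), 0 < lam x W) (hT : 0 < T)
    (hρ₀ : IsDatum 0 1 K ρ₀) (hu : IsDatum 0 T K u) :
    ∃ ρ : ℝ → ℝ → ℝ, IsWeakSolution lam T ρ₀ u ρ ∧ (∀ t x, 0 ≤ ρ t x) ∧
      ∀ p : ℝ≥0∞, 1 ≤ p → p ≠ ∞ → ContinuousInLp T p ρ := by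
  -- an upper bound for the total mass
  set B := (∫ x, ρ₀ x) + (∫ s, u s) + 1
  have hB : 0 < B := by
    have h1 : 0 ≤ ∫ x, ρ₀ x := integral_nonneg hρ₀.nonneg
    have h2 : 0 ≤ ∫ s, u s := integral_nonneg hu.nonneg
    positivity
  obtain ⟨vel, L, c, Λ, hv, hvel⟩ := exists_isVelocity_eqOn hlam_C1 hlam_pos hB
  obtain ⟨w, hw, -⟩ := existsUnique_massFunctional_fixedPoint hv hT.le hρ₀ hu
  set W := IccExtend hT.le w
  have hW : Continuous W := w.continuous.Icc_extend'
  have := hρ₀.isFiniteMeasure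
  have := hu.isFiniteMeasure
  have hK := hρ₀.bound_nonneg
  have hc := hv.c_pos
  obtain ⟨ρ, hρm, hρ0, hρK, hρν⟩ := exists_measurable_density (measurable_massAt hv hW hρ₀ hu)
    (ENNReal.add_lt_top.2 ⟨measure_lt_top (datumMeasure ρ₀) univ,
      measure_lt_top (datumMeasure u) univ⟩) (fun t => (massAt_univ hv hW t).le)
    (K := K * Real.exp (L * T) + K * (Real.exp (L * T) / c)) (by positivity)
    (S := Icc 0 T) (fun t ht => massAt_le hv hW hρ₀ hu ht)
  have hρt : ∀ t, Measurable (ρ t) := fun t =>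
    hρm.comp (measurable_const.prodMk measurable_id)
  have hLp : ∀ p : ℝ≥0∞, 1 ≤ p → p ≠ ∞ → ContinuousInLp T p ρ := fun p hp1 hp =>
    continuousInLp_of_eventually_abs_measureReal_sub_le hρt hρ0 hρK hρν
      (fun t ht ε hε => eventually_abs_massAt_sub_le hv hW hρ₀ hu ht hε) hp1 hp
  have hmass : ∀ t ∈ Icc 0 T, totalMass ρ t = W t := by
    intro t ht
    rw [totalMass, integral_zero_one, setIntegral_eq_of_restrict_eq_withDensity (hρt t) (hρ0 t)
      (hρν t ht) measurableSet_Ioo le_rfl, massAt_real_Ioo hv hW hρ₀ hu ht]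
    exact (hw ⟨t, ht⟩).trans (IccExtend_of_mem hT.le w ht).symm
  have hmass_mem : ∀ t ∈ Icc 0 T, totalMass ρ t ∈ Icc 0 B := by
    intro t ht
    have h1 := hw ⟨t, ht⟩
    rw [hmass t ht, show W t = w ⟨t, ht⟩ from IccExtend_of_mem hT.le w ht, ← h1]
    refine ⟨massBehind_nonneg hρ₀ hu _ _, (massBehind_le hρ₀ hu _ _).trans ?_⟩
    simp only [B]
    linarith
  refine ⟨ρ, ⟨hLp 1 le_rfl ENNReal.one_ne_top, ?_, fun t ht => (hmass_mem t ht).1, ?_⟩, hρ0, hLp⟩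
  · have hfin : IsFiniteMeasure (volume.restrict (Ioo 0 T ×ˢ Ioo (0 : ℝ) 1)) := by
      rw [Measure.volume_eq_prod, ← Measure.prod_restrict]
      infer_instance
    refine MemLp.of_bound hρm.aestronglyMeasurable
      (K * Real.exp (L * T) + K * (Real.exp (L * T) / c)) (Eventually.of_forall fun z => ?_)
    rw [Real.norm_eq_abs, abs_of_nonneg (hρ0 _ _)]
    exact hρK _ _
  · intro τ hτ φ hφ
    rcases hτ.1.eq_or_lt with rfl | hτ0
    · have : ∫ x in (0 : ℝ)..1, ρ₀ x * φ 0 x = ∫ x in (0 : ℝ)..1, (0 : ℝ) := by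
        refine intervalIntegral.integral_congr fun x hx => ?_
        rw [uIcc_of_le zero_le_one] at hx
        simp only [hφ.final_eq_zero x hx, mul_zero]
      simp [this]
    · have key := integral_integral_materialDeriv_massAt hv hW hρ₀ hu hτ0 hφ
      rw [intervalIntegral.integral_of_le hτ.1, intervalIntegral.integral_of_le hτ.1,
        integral_Ioc_eq_integral_Ioo, integral_Ioc_eq_integral_Ioo, integral_zero_one]
      have h1 : ∫ t in Ioo 0 τ, ∫ x in (0 : ℝ)..1,
          ρ t x * (derivWithin (fun s => φ s x) (Icc 0 τ) t +
            lam x (totalMass ρ t) * derivWithin (fun y => φ t y) (Icc 0 1) x) =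
          ∫ t in Ioo 0 τ, ∫ x, materialDeriv vel W τ φ (t, x) ∂(massAt vel ρ₀ u W t) := by
        refine setIntegral_congr_fun measurableSet_Ioo fun t ht => ?_
        have htT : t ∈ Icc 0 T := ⟨ht.1.le, ht.2.le.trans hτ.2⟩
        rw [integral_zero_one]
        have h2 : ∫ x, materialDeriv vel W τ φ (t, x) ∂(massAt vel ρ₀ u W t) =
            ∫ x in Ioo 0 1, materialDeriv vel W τ φ (t, x) ∂(massAt vel ρ₀ u W t) :=
          (setIntegral_eq_integral_of_forall_compl_eq_zero fun x hx =>
            indicator_of_notMem (fun hmem => hx hmem.2) _).symm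
        rw [h2, ← setIntegral_mul_eq_of_restrict_eq_withDensity (hρt t) (hρ0 t) (hρν t htT)]
        refine setIntegral_congr_fun measurableSet_Ioo fun x hx => ?_
        rw [hφ.materialDeriv_eq ht hx, hvel x (Ioo_subset_Icc_self hx) _ (hmass_mem t htT),
          hmass t htT]
      rw [h1, key]
      ring

/-! ### Reduction to normalised data -/

/-- Every element of `L^∞_+` has a normalised representative. -/
theorem MemLinftyPlus.exists_isDatum {a b : ℝ} {f : ℝ → ℝ} (hf : MemLinftyPlus a b f) :
    ∃ K g, IsDatum a b K g ∧ f =ᵐ[volume.restrict (Ioo a b)] g := by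
  obtain ⟨h1, h2⟩ := hf
  set K := (eLpNorm f ∞ (volume.restrict (Ioo a b))).toReal
  have hK : 0 ≤ K := ENNReal.toReal_nonneg
  have hbd : ∀ᵐ x ∂(volume.restrict (Ioo a b)), f x ≤ K := by
    filter_upwards [ae_le_eLpNormEssSup (f := f) (μ := volume.restrict (Ioo a b))] with x hx
    have := ENNReal.toReal_mono h1.2.ne (hx.trans_eq eLpNorm_exponent_top.symm)
    rw [toReal_enorm] at this
    exact (Real.le_norm_self _).trans this
  refine ⟨K, (Ioo a b).indicator fun x => max 0 (min K (h1.1.mk f x)), ⟨?_, ?_, ?_, ?_⟩, ?_⟩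
  · exact (measurable_const.max (measurable_const.min
      h1.1.stronglyMeasurable_mk.measurable)).indicator measurableSet_Ioo
  · exact fun x => indicator_nonneg (fun _ _ => le_max_left _ _) x
  · intro x
    by_cases hx : x ∈ Ioo a b
    · rw [indicator_of_mem hx]
      exact max_le hK (min_le_left _ _)
    · rwa [indicator_of_notMem hx]
  · exact fun x hx => indicator_of_notMem hx _
  · filter_upwards [h1.1.ae_eq_mk, h2, hbd, ae_restrict_mem measurableSet_Ioo] with x e1 e2 e3 e4
    rw [indicator_of_mem e4, ← e1, min_eq_right e3, max_eq_right e2]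

lemma IsDatum.mono {a b K K' : ℝ} {f : ℝ → ℝ} (hf : IsDatum a b K f) (h : K ≤ K') :
    IsDatum a b K' f :=
  ⟨hf.measurable, hf.nonneg, fun x => (hf.le x).trans h, hf.eq_zero⟩

/-- Weak solutions depend only on the classes of the data. -/
theorem IsWeakSolution.congr_data {lam : ℝ → ℝ → ℝ} {T : ℝ} {ρ₀ ρ₀' u u' : ℝ → ℝ}
    {ρ : ℝ → ℝ → ℝ} (h : IsWeakSolution lam T ρ₀ u ρ)
    (hρ₀ : ρ₀ =ᵐ[volume.restrict (Ioo 0 1)] ρ₀') (hu : u =ᵐ[volume.restrict (Ioo 0 T)] u') :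
    IsWeakSolution lam T ρ₀' u' ρ := by
  refine ⟨h.continuousInL1, h.memLinfty, h.mass_nonneg, fun τ hτ φ hφ => ?_⟩
  have hw := h.weak_eq τ hτ φ hφ
  have e1 : ∫ t in (0 : ℝ)..τ, u t * φ t 0 = ∫ t in (0 : ℝ)..τ, u' t * φ t 0 := by
    rw [intervalIntegral.integral_of_le hτ.1, intervalIntegral.integral_of_le hτ.1,
      integral_Ioc_eq_integral_Ioo, integral_Ioc_eq_integral_Ioo]
    refine integral_congr_ae ?_
    filter_upwards [ae_restrict_of_ae_restrict_of_subset (Ioo_subset_Ioo_right hτ.2) hu]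
      with t ht
    rw [ht]
  have e2 : ∫ x in (0 : ℝ)..1, ρ₀ x * φ 0 x = ∫ x in (0 : ℝ)..1, ρ₀' x * φ 0 x := by
    rw [integral_zero_one, integral_zero_one]
    refine integral_congr_ae ?_
    filter_upwards [hρ₀] with x hx
    rw [hx]
  rwa [e1, e2] at hw

end NonlocalConservation

end

/-- Well-posedness with `L^∞` data. Functions of `(t,x)` represent classes in
`C⁰([0,T]; L¹(0,1))`, so uniqueness is equality of `ρ' t` and `ρ t` in `L¹(0,1)` for every
`t ∈ [0,T]`. -/
theorem mainTheorem1
    (lam : ℝ → ℝ → ℝ)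
    (hlam_C1 : ContDiffOn ℝ 1 (fun z : ℝ × ℝ => lam z.1 z.2) (Icc 0 1 ×ˢ Ici 0))
    (hlam_pos : ∀ x ∈ Icc (0 : ℝ) 1, ∀ W ∈ Ici (0 : ℝ), 0 < lam x W)
    (T : ℝ) (hT : 0 < T)
    (ρ₀ : ℝ → ℝ) (hρ₀ : NonlocalConservation.MemLinftyPlus 0 1 ρ₀)
    (u : ℝ → ℝ) (hu : NonlocalConservation.MemLinftyPlus 0 T u) :
    ∃ ρ : ℝ → ℝ → ℝ,
      NonlocalConservation.IsWeakSolution lam T ρ₀ u ρ ∧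
      (∀ ρ' : ℝ → ℝ → ℝ, NonlocalConservation.IsWeakSolution lam T ρ₀ u ρ' →
        ∀ t ∈ Icc 0 T, ρ' t =ᵐ[volume.restrict (Ioo 0 1)] ρ t) ∧
      (∀ᵐ z : ℝ × ℝ ∂(volume.restrict (Icc 0 T ×ˢ Icc 0 1)), 0 ≤ ρ z.1 z.2) ∧
      (∀ p : ℝ≥0∞, 1 ≤ p → p ≠ ∞ → NonlocalConservation.ContinuousInLp T p ρ) := by
  obtain ⟨K₁, r, hr, hρr⟩ := hρ₀.exists_isDatum
  obtain ⟨K₂, v, hv, huv⟩ := hu.exists_isDatum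
  have hr' := hr.mono (le_max_left K₁ K₂)
  have hv' := hv.mono (le_max_right K₁ K₂)
  obtain ⟨ρ, hsol, hnonneg, hLp⟩ :=
    NonlocalConservation.exists_isWeakSolution hlam_C1 hlam_pos hT hr' hv'
  refine ⟨ρ, hsol.congr_data hρr.symm huv.symm, fun ρ' h' t ht => ?_,
    Eventually.of_forall fun z => hnonneg _ _, hLp⟩
  exact hsol.ae_eq hlam_C1 hlam_pos hT hr' hv' (h'.congr_data hρr huv) ht
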